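/- **Theorem (matrix model for rank one non-Hermitian perturbations of Gaussian and Wishart ensembles).** Let $(K,\beta)$ be one of $(\mathbb R,1)$, $(\mathbb C,2)$, $(\mathbb H,4)$, and call a $K$-valued random variable *standard normal* if its $\beta$ real coordinates are independent $N(0,1)$ variables. Let $H$ be an $n\times n$ random matrix over $K$ of one of the following two types: * (Gaussian) $H$ has the law of $\tfrac12(Y+Y^*)$, where $Y$ is an $n\times n$ matrix with i.i.d. standard normal entries in $K$ ($GOE_n$, $GUE_n$, $GSE_n$ for $\beta=1,2,4$); * (Wishart) $H$ has the law of $Y^*Y$, where $Y$ is an $m\times n$ matrix with i.i.d. standard normal entries in $K$ ($LOE_{(m,n)}$, $LUE_{(m,n)}$, $LSE_{(m,n)}$ for $\beta=1,2,4$). Let $\Gamma$ be an $n\times n$ random matrix over $K$, on the same probability space as $H$ and independent of $H$, which is almost surely Hermitian positive semidefinite of rank one (for $K=\mathbb H$: of right rank one over $\mathbb H$). Put $l=\|\Gamma\|_{HS}=\bigl(\sum_{j,k=1}^n|\Gamma_{jk}|^2\bigr)^{1/2}$, and let $I_{1\times1}$ be the $n\times n$ matrix with $(1,1)$-entry $1$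 and all other entries $0$. Then there are, on the same probability space, a random unitary matrix $V$ over $K$ (orthogonal, unitary, or unitary symplectic for $\beta=1,2,4$) and a random real symmetric tridiagonal $n\times n$ matrix $\mathcal J$, independent of $l$, such that almost surely $$V\,(H+i\Gamma)\,V^*=\mathcal J+i\,l\,I_{1\times1}.$$ For $K=\mathbb H$ the imaginary unit $i$ commutes with the quaternions; that is, quaternions are represented in the standard way by $2\times2$ complex matrices and the identity is one between $2n\times 2n$ complex matrices, with the real numbers in $\mathcal J$ and $I_{1\times 1}$ representing multiples of the $2\times2$ identity. The law of $\mathcal J$ is as follows. Let $\chi_k$ and $\tilde\chi_k$ ($k>0$) denote the laws on $(0,\infty)$ with densities $\tfrac{2^{1-k/2}}{\Gamma(k/2)}x^{k-1}e^{-x^2/2}$ and $\tfrac{2}{\Gamma(k/2)}x^{k-1}e^{-x^2}$ (here $\Gamma(\cdot)$ is the gamma function). * (Gaussian) $\mathcal J$ has diagonal entries $b_1,\dots,b_n$ and off-diagonal entries $a_1,\dots,a_{n-1}$, all independent, with $b_j\sim N(0,1)$ for $1\le j\le n$ and $a_j\sim\tilde\chi_{\beta(n-j)}$ for $1\le j\le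 n-1$. * (Wishart) $\mathcal J$ has the law of $B^*B$, where $B$ is the $n\times n$ upper bidiagonal matrix with diagonal $x_1,\dots,x_n$ and superdiagonal $y_1,\dots,y_{n-1}$, all independent. If $m\ge n$, then $x_j\sim\chi_{\beta(m-j+1)}$ for $1\le j\le n$ and $y_j\sim\chi_{\beta(n-j)}$ for $1\le j\le n-1$. If $m\le n-1$, then $x_j\sim\chi_{\beta(m-j+1)}$ and $y_j\sim\chi_{\beta(n-j)}$ for $1\le j\le m$, while $x_j=0$ for $m+1\le j\le n$ and $y_j=0$ for $m+1\le j\le n-1$. -/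

import Mathlib

open MeasureTheory ProbabilityTheory
open scoped Quaternion Matrix

noncomputable section

namespace RankOnePerturbation

/-! ### Measurable structures -/

/-- The Borel sigma-algebra on the real quaternions. -/
instance instMeasurableSpaceQuaternion : MeasurableSpace ℍ[ℝ] := borel ℍ[ℝ]

/-- The product sigma-algebra on matrices (generated by the entries). -/
instance instMeasurableSpaceMatrix {ι κ K : Type*} [MeasurableSpace K] :
    MeasurableSpace (Matrix ι κ K) :=
  MeasurableSpace.pi (X := fun _ : ι => κ → K)

/-! ### Scalar distributions -/

/-- The law of a complex variable whose real and imaginary parts are independent standard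
normal variables. -/
def gaussianComplex : Measure ℂ :=
  ((gaussianReal 0 1).prod (gaussianReal 0 1)).map fun p => ⟨p.1, p.2⟩

/-- The law of a quaternionic variable whose four coordinates are independent standard normal
variables. -/
def gaussianQuaternion : Measure ℍ[ℝ] :=
  (Measure.pi fun _ : Fin 4 => gaussianReal 0 1).map (Quaternion.equivTuple ℝ).symm

/-- The `χ_k` law for a real parameter `k > 0`, given by its density on `(0, ∞)`. -/
def chi (k : ℝ) : Measure ℝ :=
  (volume.restrict (Set.Ioi 0)).withDensity fun x =>
    ENNReal.ofReal (2 ^ (1 - k / 2) / Real.Gamma (k / 2) * x ^ (k - 1) * Real.exp (-x ^ 2 / 2))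

/-- The rescaled law of `χ_k / √2` for a real parameter `k > 0`, given by its density on
`(0, ∞)`. -/
def chiTilde (k : ℝ) : Measure ℝ :=
  (volume.restrict (Set.Ioi 0)).withDensity fun x =>
    ENNReal.ofReal (2 / Real.Gamma (k / 2) * x ^ (k - 1) * Real.exp (-x ^ 2))

/-! ### The six full-matrix ensembles -/

section Ensembles

variable {K : Type*} [Ring K] [StarRing K] [MeasurableSpace K]

/-- The law of an `m × n` matrix with i.i.d. entries of law `γ`. -/
def iidMatrix (γ : Measure K) (m n : ℕ) : Measure (Matrix (Fin m) (Fin n) K) :=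
  (Measure.pi fun _ : Fin m => Measure.pi fun _ : Fin n => γ).map fun w => Matrix.of w

/-- The law of `(Y + Y*) / 2` for an `n × n` matrix `Y` with i.i.d. entries of law `γ`. -/
def hermitianEnsemble [Module ℝ K] (γ : Measure K) (n : ℕ) :
    Measure (Matrix (Fin n) (Fin n) K) :=
  (iidMatrix γ n n).map fun Y => (1 / 2 : ℝ) • (Y + Yᴴ)

/-- The law of the `n × n` matrix `Y* Y` for an `m × n` matrix `Y` with i.i.d. entries of
law `γ`. -/
def wishartEnsemble (γ : Measure K) (m n : ℕ) : Measure (Matrix (Fin n) (Fin n) K) :=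
  (iidMatrix γ m n).map fun Y => Yᴴ * Y

end Ensembles

/-- Gaussian orthogonal ensemble. -/
def GOE (n : ℕ) : Measure (Matrix (Fin n) (Fin n) ℝ) := hermitianEnsemble (gaussianReal 0 1) n

/-- Gaussian unitary ensemble. -/
def GUE (n : ℕ) : Measure (Matrix (Fin n) (Fin n) ℂ) := hermitianEnsemble gaussianComplex n

/-- Gaussian symplectic ensemble. -/
def GSE (n : ℕ) : Measure (Matrix (Fin n) (Fin n) ℍ[ℝ]) := hermitianEnsemble gaussianQuaternion n

/-- Wishart orthogonal ensemble. -/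
def LOE (m n : ℕ) : Measure (Matrix (Fin n) (Fin n) ℝ) := wishartEnsemble (gaussianReal 0 1) m n

/-- Wishart unitary ensemble. -/
def LUE (m n : ℕ) : Measure (Matrix (Fin n) (Fin n) ℂ) := wishartEnsemble gaussianComplex m n

/-- Wishart symplectic ensemble. -/
def LSE (m n : ℕ) : Measure (Matrix (Fin n) (Fin n) ℍ[ℝ]) :=
  wishartEnsemble gaussianQuaternion m n

/-! ### The tridiagonal models -/

/-- The symmetric tridiagonal matrix with diagonal `b` and off-diagonal `a`. -/
def jacobi {n : ℕ} (a : Fin (n - 1) → ℝ) (b : Fin n → ℝ) : Matrix (Fin n) (Fin n) ℝ :=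
  Matrix.of fun i j =>
    if i = j then b i
    else if h : i.val + 1 = j.val then a ⟨i.val, by omega⟩
    else if h : j.val + 1 = i.val then a ⟨j.val, by omega⟩
    else 0

/-- The upper bidiagonal matrix with diagonal `x` and superdiagonal `y`. -/
def bidiagonal {n : ℕ} (x : Fin n → ℝ) (y : Fin (n - 1) → ℝ) : Matrix (Fin n) (Fin n) ℝ :=
  Matrix.of fun i j =>
    if i = j then x i
    else if h : i.val + 1 = j.val then y ⟨i.val, by omega⟩
    else 0

/-- The law of the Jacobi matrix with independent coefficients
`a_j ∼ χ̃_{β (n - j)}` for `1 ≤ j ≤ n - 1` and `b_j ∼ N(0, 1)` for `1 ≤ j ≤ n`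
(the index `i` below is `j - 1`). -/
def gaussianBetaEnsemble (β : ℝ) (n : ℕ) : Measure (Matrix (Fin n) (Fin n) ℝ) :=
  ((Measure.pi fun i : Fin (n - 1) => chiTilde (β * ((n : ℝ) - ((i.val : ℝ) + 1)))).prod
    (Measure.pi fun _ : Fin n => gaussianReal 0 1)).map fun p => jacobi p.1 p.2

/-- The law of `Bᵀ B`, where `B` is upper bidiagonal with independent entries:
diagonal `x_j ∼ χ_{β (m - j + 1)}` if `j ≤ m` and `x_j = 0` if `m < j ≤ n`;
superdiagonal `y_j ∼ χ_{β (n - j)}` if `j ≤ m` and `y_j = 0` if `m < j ≤ n - 1`.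
If `m ≥ n` the zero cases are void. (The index `i` below is `j - 1`.) -/
def laguerreBetaEnsemble (β : ℝ) (m n : ℕ) : Measure (Matrix (Fin n) (Fin n) ℝ) :=
  ((Measure.pi fun i : Fin n =>
      if i.val < m then chi (β * ((m : ℝ) - ((i.val : ℝ) + 1) + 1)) else Measure.dirac 0).prod
    (Measure.pi fun i : Fin (n - 1) =>
      if i.val < m then chi (β * ((n : ℝ) - ((i.val : ℝ) + 1))) else Measure.dirac 0)).map
    fun p => (bidiagonal p.1 p.2)ᵀ * bidiagonal p.1 p.2

/-! ### Rank one positive matrices and the Hilbert-Schmidt norm -/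

/-- Positive semidefiniteness over `ℝ`, `ℂ` or `ℍ`: the matrix is Hermitian and every `x* G x`
is a nonnegative real number. -/
def IsPositive {K : Type*} [Ring K] [StarRing K] [Algebra ℝ K] {n : ℕ}
    (G : Matrix (Fin n) (Fin n) K) : Prop :=
  G.IsHermitian ∧ ∀ x : Fin n → K, ∃ r : ℝ, 0 ≤ r ∧ star x ⬝ᵥ (G *ᵥ x) = algebraMap ℝ K r

/-- The right column rank of a matrix over a division ring: the dimension of the right span of
its columns. (Right vector spaces are modules over the opposite ring.) -/
def rightRank {K : Type*} [DivisionRing K] {n : ℕ} (G : Matrix (Fin n) (Fin n) K) : ℕ :=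
  Module.finrank Kᵐᵒᵖ (Submodule.span Kᵐᵒᵖ (Set.range fun j : Fin n => fun i : Fin n => G i j))

/-- The Hilbert-Schmidt norm. -/
def hsNorm {K : Type*} [Norm K] {n : ℕ} (G : Matrix (Fin n) (Fin n) K) : ℝ :=
  Real.sqrt (∑ j, ∑ k, ‖G j k‖ ^ 2)

/-- The `n × n` matrix whose `(1,1)`-entry is `1` and whose other entries are `0`. -/
def topLeft (A : Type*) [Zero A] [One A] (n : ℕ) : Matrix (Fin n) (Fin n) A :=
  Matrix.of fun i j => if i.val = 0 ∧ j.val = 0 then 1 else 0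

/-! ### The effective matrix and its model -/

/-- The standard representation of a quaternion as a `2 × 2` complex matrix. -/
def quaternionToMatrix (q : ℍ[ℝ]) : Matrix (Fin 2) (Fin 2) ℂ :=
  !![⟨q.re, q.imI⟩, ⟨q.imJ, q.imK⟩; ⟨-q.imJ, q.imK⟩, ⟨q.re, -q.imI⟩]

/-- `H + i G`. Here `ρ` is the inclusion of the scalars `K` into a complex algebra `A` in which
the imaginary unit `i` is central: `ℝ ⊂ ℂ`, `ℂ = ℂ`, or `ℍ ⊂ M₂(ℂ)`. In the last case the result
is a `2n × 2n` complex matrix written in `2 × 2` blocks. -/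
def effective {K A : Type*} [Ring A] [Algebra ℂ A] (ρ : K → A) {n : ℕ}
    (H G : Matrix (Fin n) (Fin n) K) : Matrix (Fin n) (Fin n) A :=
  H.map ρ + Complex.I • G.map ρ

/-- `J + i l I_{1×1}` for a real matrix `J` and a real number `l`. -/
def perturbedModel (A : Type*) [Ring A] [Algebra ℂ A] {n : ℕ}
    (J : Matrix (Fin n) (Fin n) ℝ) (l : ℝ) : Matrix (Fin n) (Fin n) A :=
  J.map (fun t => algebraMap ℂ A (t : ℂ)) + (Complex.I * (l : ℂ)) • topLeft A n

section Random

variable {Ω : Type*} [MeasurableSpace Ω]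

/-- `G` is a random matrix, almost surely positive semidefinite of rank one, independent
of `H`. -/
structure IsRankOnePerturbation {K : Type*} [DivisionRing K] [StarRing K] [Algebra ℝ K]
    [MeasurableSpace K] (μ : Measure Ω) {n : ℕ} (H G : Ω → Matrix (Fin n) (Fin n) K) : Prop where
  aemeasurable : AEMeasurable G μ
  positive : ∀ᵐ ω ∂μ, IsPositive (G ω)
  rank_eq_one : ∀ᵐ ω ∂μ, rightRank (G ω) = 1
  indep : IndepFun H G μ

/-- Almost surely `H + i G` is unitarily equivalent to `J + i l I_{1×1}`, where `J` is a random
real matrix of law `ν`, `l` is the Hilbert-Schmidt norm of `G`, and `J` and `l` are independent.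
The unitary matrix `V` has entries in `K` (it is orthogonal, unitary, or unitary symplectic for
`K = ℝ, ℂ, ℍ`) and is itself a random matrix. -/
def HasTridiagonalModel {K A : Type*} [NormedRing K] [StarRing K] [MeasurableSpace K]
    [Ring A] [StarRing A] [Algebra ℂ A] (ρ : K → A) (μ : Measure Ω) {n : ℕ}
    (H G : Ω → Matrix (Fin n) (Fin n) K) (ν : Measure (Matrix (Fin n) (Fin n) ℝ)) : Prop :=
  ∃ (V : Ω → Matrix (Fin n) (Fin n) K) (J : Ω → Matrix (Fin n) (Fin n) ℝ),
    Measurable V ∧ (∀ ω, V ω ∈ unitary (Matrix (Fin n) (Fin n) K)) ∧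
    HasLaw J ν μ ∧
    IndepFun J (fun ω => hsNorm (G ω)) μ ∧
    ∀ᵐ ω ∂μ, (V ω).map ρ * effective ρ (H ω) (G ω) * ((V ω).map ρ)ᴴ =
      perturbedModel A (J ω) (hsNorm (G ω))

end Random

end RankOnePerturbation

end

noncomputable section

namespace RankOnePerturbation

set_option linter.unusedSectionVars false

/-! ### The norm of a standard Gaussian vector -/

/-! Both ensembles are invariant in law under conjugation by a fixed unitary matrix. Choose a
unitary `U`, depending measurably on `Γ` alone, with `U Γ U* = l E₁₁`. Since `H` is independent of
`Γ`, the matrix `X = U H U*` again has the law of `H`, whatever `Γ` is, so it is independent of `Γ`.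
Householder's algorithm now gives a unitary `W`, built from `X`, such that `W X W*` is real
tridiagonal. It acts only on the coordinates after the first, so `W` fixes the first basis vector
and leaves `l E₁₁` unchanged. Then `V = W U` works, and `𝒥 = W X W*` is a function of `X`, hence
independent of `l`. This is `hasTridiagonalModel_of_invariant`.

It remains to find the law of the tridiagonal form, by induction on the size. For a Gaussian `H`,
the corner, the rest `v` of the first column and the remaining block are independent. The reflection
that sends `v` to `‖v‖ e₁` depends on `v` only, so conjugating the block by it changes neither the
law of the block nor its independence of `v`. The new coefficients are thus a normal variable and
`‖v‖`, and the next block is a smaller copy of the ensemble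
(`measurePreserving_tridiagonal_gaussHermitian`).

For `Y* Y`, let `c` be the first column of `Y`. A unitary on the left does not change `Y* Y`; the
reflection taking `c` to `‖c‖ e₁` turns `Y` into a block matrix with first row `(‖c‖, r)` and lower
block `(0, Z)`, where `c`, `r`, `Z` are independent and Gaussian. A reflection on the right taking
`r*` to `‖r‖ e₁` preserves the law of `Z`. What is left is the Gram matrix of a matrix with one row
and one column fewer, plus `‖r‖² E₁₁`, and the algorithm commutes with such a corner term. This is
the block recursion of `BᵀB` with `x₁ = ‖c‖`, `y₁ = ‖r‖` (`measurePreserving_tridiagonal_gram`).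

All three fields are treated at once through `GaussianScalars`. Every invariance or splitting of
Gaussian matrices is an instance of one fact, `IsStdGaussian.measurePreserving`: real-linear
isometries preserve the standard Gaussian measure. "Same law for each value of an independent
variable" is expressed by `MeasurePreserving.skew_product`. -/

theorem stdGaussian_eq_withDensity (E : Type*) [NormedAddCommGroup E] [InnerProductSpace ℝ E]
    [FiniteDimensional ℝ E] [MeasurableSpace E] [BorelSpace E] :
    ∃ c : ℝ, 0 < c ∧ stdGaussian E =
      (volume : Measure E).withDensity fun x => ENNReal.ofReal (c * Real.exp (-‖x‖ ^ 2 / 2)) := by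
  have hb : (0 : ℝ) < ((1 / 2 : ℂ)).re := by norm_num
  have hbase : (0 : ℝ) < 2 * Real.pi := by positivity
  set d : ℝ := (2 * Real.pi) ^ ((Module.finrank ℝ E : ℝ) / 2) with hd
  have hdpos : 0 < d := Real.rpow_pos_of_pos hbase _
  have hfour (t : E) : ∫ v : E, Complex.exp (-(1 / 2 : ℂ) * ‖v‖ ^ 2 + Complex.I * inner ℝ t v)
      = d * Complex.exp (-‖t‖ ^ 2 / 2) := by
    rw [GaussianFourier.integral_cexp_neg_mul_sq_norm_add hb]
    congr 1
    · rw [hd, Complex.ofReal_cpow hbase.le]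
      congr 1
      · push_cast; ring
      · push_cast; ring
    · congr 1
      rw [Complex.I_sq]; ring
  have hint : Integrable (fun x : E => d⁻¹ * Real.exp (-‖x‖ ^ 2 / 2)) := by
    have h := (GaussianFourier.integrable_cexp_neg_mul_sq_norm_add (V := E) hb 0 0).norm
    refine (h.congr ?_).const_mul _
    filter_upwards with x
    rw [Complex.norm_exp]
    congr 1
    simp [← Complex.ofReal_pow]
    ring
  refine ⟨d⁻¹, inv_pos.2 hdpos, ?_⟩
  have : IsFiniteMeasure ((volume : Measure E).withDensity
      fun x => ENNReal.ofReal (d⁻¹ * Real.exp (-‖x‖ ^ 2 / 2))) :=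
    isFiniteMeasure_withDensity_ofReal hint.2
  -- Two finite measures with the same characteristic function agree; the density's transform is the
  -- Gaussian Fourier integral, with `d = (2π)^(dim/2)` as normalization.
  apply Measure.ext_of_charFun
  funext t
  rw [charFun_stdGaussian, charFun_apply, integral_withDensity_eq_integral_toReal_smul
    (by fun_prop) (by simp)]
  have h1 : ∀ x : E, (ENNReal.ofReal (d⁻¹ * Real.exp (-‖x‖ ^ 2 / 2))).toReal •
      Complex.exp (inner ℝ x t * Complex.I) =
      (d⁻¹ : ℂ) * Complex.exp (-(1 / 2 : ℂ) * ‖x‖ ^ 2 + Complex.I * inner ℝ t x) := by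
    intro x
    rw [ENNReal.toReal_ofReal (by positivity), Complex.real_smul, real_inner_comm t x]
    push_cast
    rw [mul_assoc, ← Complex.exp_add]
    congr 3 <;> ring
  simp_rw [h1]
  rw [integral_const_mul, hfour, ← mul_assoc, inv_mul_cancel₀ (by exact_mod_cast hdpos.ne'), one_mul]

/-- Polar coordinates: off the origin, a null set because `E` is nontrivial, volume is the product
of the sphere measure and `y ^ (dim - 1) dy`. -/
theorem lintegral_comp_norm {E : Type*} [NormedAddCommGroup E] [InnerProductSpace ℝ E]
    [FiniteDimensional ℝ E] [Nontrivial E] [MeasurableSpace E] [BorelSpace E]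
    {f : ℝ → ENNReal} (hf : Measurable f) :
    ∫⁻ x : E, f ‖x‖ = (volume : Measure E).toSphere Set.univ *
      ∫⁻ y in Set.Ioi (0 : ℝ), ENNReal.ofReal (y ^ (Module.finrank ℝ E - 1)) * f y := by
  calc
    ∫⁻ x : E, f ‖x‖ = ∫⁻ x : ({(0)}ᶜ : Set E), f ‖x.1‖ ∂((volume : Measure E).comap (↑)) := by
      rw [lintegral_subtype_comap (measurableSet_singleton _).compl fun x : E ↦ f (‖x‖),
        restrict_compl_singleton]
    _ = ∫⁻ x, f x.2 ∂(volume : Measure E).toSphere.prod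
        (.volumeIoiPow (Module.finrank ℝ E - 1)) := by
      simpa using (volume : Measure E).measurePreserving_homeomorphUnitSphereProd.lintegral_comp_emb
        (Homeomorph.measurableEmbedding _) (f ∘ Subtype.val ∘ Prod.snd)
    _ = (volume : Measure E).toSphere Set.univ *
        ∫⁻ x : Set.Ioi (0 : ℝ), f x ∂.volumeIoiPow (Module.finrank ℝ E - 1) := by
      rw [lintegral_prod _ (by fun_prop)]
      simp only [lintegral_const]
      rw [mul_comm]
    _ = _ := by
      rw [Measure.volumeIoiPow, lintegral_withDensity_eq_lintegral_mul _ (by fun_prop) (by fun_prop),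
        ← lintegral_subtype_comap measurableSet_Ioi
          fun a : ℝ ↦ ENNReal.ofReal (a ^ (Module.finrank ℝ E - 1)) * f a]
      rfl

theorem map_norm_stdGaussian {E : Type*} [NormedAddCommGroup E] [InnerProductSpace ℝ E]
    [FiniteDimensional ℝ E] [Nontrivial E] [MeasurableSpace E] [BorelSpace E] :
    ∃ c : ENNReal, (stdGaussian E).map (‖·‖) = c • (volume.restrict (Set.Ioi 0)).withDensity
      fun x : ℝ => ENNReal.ofReal (x ^ (Module.finrank ℝ E - 1) * Real.exp (-x ^ 2 / 2)) := by
  obtain ⟨c, hc, h⟩ := stdGaussian_eq_withDensity E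
  refine ⟨ENNReal.ofReal c * (volume : Measure E).toSphere Set.univ, ?_⟩
  refine Measure.ext_of_lintegral _ fun f hf => ?_
  rw [lintegral_map hf (by fun_prop), h,
    lintegral_withDensity_eq_lintegral_mul _ (by fun_prop) (by fun_prop), lintegral_smul_measure,
    lintegral_withDensity_eq_lintegral_mul _ (by fun_prop) (by fun_prop)]
  simp only [Pi.mul_apply]
  rw [lintegral_comp_norm (f := fun r => ENNReal.ofReal (c * Real.exp (-r ^ 2 / 2)) * f r)
    (by fun_prop), smul_eq_mul, mul_comm (ENNReal.ofReal c), mul_assoc]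
  congr 1
  rw [← lintegral_const_mul _ (by fun_prop)]
  refine setLIntegral_congr_fun measurableSet_Ioi fun y hy => ?_
  have hy : 0 < y := hy
  rw [ENNReal.ofReal_mul hc.le, ENNReal.ofReal_mul (by positivity)]
  ring

theorem chi_univ {k : ℝ} (hk : 0 < k) : chi k Set.univ = 1 := by
  have hG : 0 < Real.Gamma (k / 2) := Real.Gamma_pos_of_pos (by positivity)
  have key : ∫ x in Set.Ioi (0 : ℝ), x ^ (k - 1) * Real.exp (-x ^ 2 / 2) =
      (2 ^ (1 - k / 2) / Real.Gamma (k / 2))⁻¹ := by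
    have := integral_rpow_mul_exp_neg_mul_rpow (p := 2) (q := k - 1) (b := 1 / 2) (by norm_num)
      (by linarith) (by norm_num)
    have h2 : ∀ x : ℝ, -(1 / 2) * x ^ (2 : ℝ) = -x ^ 2 / 2 := fun x => by
      rw [Real.rpow_two]; ring
    simp only [h2] at this
    rw [this, sub_add_cancel, Real.rpow_sub (by norm_num), Real.rpow_one, one_div,
      Real.inv_rpow (by norm_num), neg_div, Real.rpow_neg (by norm_num), inv_inv]
    field_simp
  -- A non-integrable function has Bochner integral zero, so the nonzero value in `key` already
  -- gives integrability.
  have hint : IntegrableOn (fun x : ℝ => x ^ (k - 1) * Real.exp (-x ^ 2 / 2)) (Set.Ioi 0) :=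
    Integrable.of_integral_ne_zero (by rw [key]; positivity)
  rw [chi, withDensity_apply _ MeasurableSet.univ, Measure.restrict_univ,
    ← ofReal_integral_eq_lintegral_ofReal]
  · simp_rw [mul_assoc]
    rw [integral_const_mul, key, mul_inv_cancel₀ (by positivity), ENNReal.ofReal_one]
  · simp_rw [mul_assoc]
    exact hint.const_mul _
  · filter_upwards [ae_restrict_mem measurableSet_Ioi] with x hx
    have hx : 0 < x := hx
    simp only [Pi.zero_apply]
    positivity

theorem isProbabilityMeasure_chi {k : ℝ} (hk : 0 < k) : IsProbabilityMeasure (chi k) :=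
  ⟨chi_univ hk⟩

/-- Both sides are multiples of one measure `ν` and both have mass one, so the constants agree. The
area of the sphere never has to be computed. -/
theorem map_norm_stdGaussian_eq_chi {E : Type*} [NormedAddCommGroup E] [InnerProductSpace ℝ E]
    [FiniteDimensional ℝ E] [Nontrivial E] [MeasurableSpace E] [BorelSpace E] :
    (stdGaussian E).map (‖·‖) = chi (Module.finrank ℝ E) := by
  obtain ⟨c, hc⟩ := map_norm_stdGaussian (E := E)
  have hd : 0 < Module.finrank ℝ E := Module.finrank_pos
  have hd' : (0 : ℝ) < Module.finrank ℝ E := by exact_mod_cast hd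
  set ν := (volume.restrict (Set.Ioi 0)).withDensity
      fun x : ℝ => ENNReal.ofReal (x ^ (Module.finrank ℝ E - 1) * Real.exp (-x ^ 2 / 2)) with hν
  obtain ⟨c', hc'⟩ : ∃ c' : ENNReal, chi (Module.finrank ℝ E) = c' • ν := by
    have hG : 0 < Real.Gamma ((Module.finrank ℝ E : ℝ) / 2) :=
      Real.Gamma_pos_of_pos (by positivity)
    refine ⟨ENNReal.ofReal (2 ^ (1 - (Module.finrank ℝ E : ℝ) / 2) /
      Real.Gamma ((Module.finrank ℝ E : ℝ) / 2)), ?_⟩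
    rw [hν, ← withDensity_smul _ (by fun_prop), chi]
    refine withDensity_congr_ae ?_
    filter_upwards [ae_restrict_mem measurableSet_Ioi] with x hx
    simp only [Pi.smul_apply, smul_eq_mul]
    rw [← ENNReal.ofReal_mul (by positivity), mul_assoc,
      ← Real.rpow_natCast x (Module.finrank ℝ E - 1), Nat.cast_pred hd]
  have h1 : c * ν Set.univ = 1 := by
    have : IsProbabilityMeasure ((stdGaussian E).map (‖·‖)) :=
      Measure.isProbabilityMeasure_map (by fun_prop)
    rw [← smul_eq_mul, ← Measure.smul_apply, ← hc]; exact measure_univ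
  have h2 : c' * ν Set.univ = 1 := by
    rw [← smul_eq_mul, ← Measure.smul_apply, ← hc']; exact chi_univ hd'
  rw [hc, hc', ENNReal.eq_inv_of_mul_eq_one_left h1, ENNReal.eq_inv_of_mul_eq_one_left h2]

theorem map_inv_sqrt_two_mul_chi {k : ℝ} (hk : 0 < k) :
    (chi k).map (fun x => (√2)⁻¹ * x) = chiTilde k := by
  have hs : 0 < √(2 : ℝ) := by positivity
  have hG : 0 < Real.Gamma (k / 2) := Real.Gamma_pos_of_pos (by positivity)
  refine Measure.ext_of_lintegral _ fun f hf => ?_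
  rw [lintegral_map hf (by fun_prop), chi, chiTilde,
    lintegral_withDensity_eq_lintegral_mul _ (by fun_prop) (by fun_prop),
    lintegral_withDensity_eq_lintegral_mul _ (by fun_prop) (by fun_prop)]
  have hmap : Measure.map (fun x : ℝ => √2 * x) (volume.restrict (Set.Ioi 0)) =
      ENNReal.ofReal (√2)⁻¹ • volume.restrict (Set.Ioi 0) := by
    have h := Real.map_volume_mul_left (a := √2) hs.ne'
    have hpre : (fun x : ℝ => √2 * x) ⁻¹' Set.Ioi 0 = Set.Ioi 0 := by
      ext x; simp [hs]
    conv_lhs => rw [← hpre]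
    rw [← Measure.restrict_map (by fun_prop) measurableSet_Ioi, h, abs_of_pos (inv_pos.2 hs),
      Measure.restrict_smul]
  -- Substituting `√2 x` on the `chi` side undoes the factor `(√2)⁻¹`; the Jacobian `√2` and the
  -- powers of two in the density then combine to the constant `2`.
  have h3 : (volume.restrict (Set.Ioi 0) : Measure ℝ) =
      ENNReal.ofReal (√2) • Measure.map (fun x : ℝ => √2 * x) (volume.restrict (Set.Ioi 0)) := by
    rw [hmap, smul_smul, ← ENNReal.ofReal_mul hs.le, mul_inv_cancel₀ hs.ne', ENNReal.ofReal_one,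
      one_smul]
  conv_lhs => rw [h3]
  rw [lintegral_smul_measure, lintegral_map (by fun_prop) (by fun_prop), smul_eq_mul,
    ← lintegral_const_mul _ (by fun_prop)]
  refine setLIntegral_congr_fun measurableSet_Ioi fun x hx => ?_
  have hx : 0 < x := hx
  simp only [Pi.mul_apply]
  rw [inv_mul_cancel_left₀ hs.ne', ← mul_assoc, ← ENNReal.ofReal_mul hs.le]
  congr 2
  rw [Real.mul_rpow hs.le hx.le, mul_pow, Real.sq_sqrt (by norm_num),
    show -(2 * x ^ 2) / 2 = -x ^ 2 by ring, Real.sqrt_eq_rpow, ← Real.rpow_mul (by norm_num)]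
  have : (2 : ℝ) ^ (1 / 2 : ℝ) * 2 ^ (1 - k / 2) * 2 ^ (1 / 2 * (k - 1)) = 2 := by
    rw [← Real.rpow_add (by norm_num), ← Real.rpow_add (by norm_num)]
    ring_nf; simp
  calc _ = ((2 : ℝ) ^ (1 / 2 : ℝ) * 2 ^ (1 - k / 2) * 2 ^ (1 / 2 * (k - 1))) /
        Real.Gamma (k / 2) * x ^ (k - 1) * Real.exp (-x ^ 2) := by ring
    _ = _ := by rw [this]

theorem isProbabilityMeasure_chiTilde {k : ℝ} (hk : 0 < k) : IsProbabilityMeasure (chiTilde k) := by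
  have := isProbabilityMeasure_chi hk
  rw [← map_inv_sqrt_two_mul_chi hk]
  exact Measure.isProbabilityMeasure_map (by fun_prop)

/-! ### Standard Gaussian measures with respect to a quadratic form -/

/-- The measure `μ` is the standard Gaussian measure of the real vector space `E`, on which the
quadratic form `N` is a sum of squares in linear coordinates indexed by `ι`. -/
def IsStdGaussian {E : Type*} [AddCommGroup E] [Module ℝ E] [MeasurableSpace E]
    (ι : Type) [Fintype ι] (N : E → ℝ) (μ : Measure E) : Prop :=
  ∃ e : (ι → ℝ) ≃ₗ[ℝ] E, Measurable e ∧ (∀ x, N (e x) = ∑ i, x i ^ 2) ∧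
    μ = (Measure.pi fun _ : ι => gaussianReal 0 1).map e

/-- Rotation invariance: a map preserving sums of squares is a Euclidean isometry, and equal
dimensions make it an isometric equivalence, under which `stdGaussian` is invariant. -/
theorem map_pi_gaussianReal_of_sum_sq {ι κ : Type} [Fintype ι] [Fintype κ]
    (L : (ι → ℝ) →ₗ[ℝ] (κ → ℝ)) (hL : ∀ x, ∑ j, L x j ^ 2 = ∑ i, x i ^ 2)
    (hc : Fintype.card ι = Fintype.card κ) :
    (Measure.pi fun _ : ι => gaussianReal 0 1).map L = Measure.pi fun _ : κ => gaussianReal 0 1 := by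
  let L' : EuclideanSpace ℝ ι →ₗᵢ[ℝ] EuclideanSpace ℝ κ :=
    { toLinearMap := (WithLp.linearEquiv 2 ℝ (κ → ℝ)).symm.toLinearMap ∘ₗ L ∘ₗ
        (WithLp.linearEquiv 2 ℝ (ι → ℝ)).toLinearMap
      norm_map' := fun x => by
        simp [EuclideanSpace.norm_eq, hL] }
  let L'' := L'.toLinearIsometryEquiv (by simpa using hc)
  have h := stdGaussian_map L''
  rw [← map_pi_eq_stdGaussian, ← map_pi_eq_stdGaussian,
    Measure.map_map (by fun_prop) (by fun_prop)] at h
  have hLm : Measurable L := L.continuous_of_finiteDimensional.measurable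
  have h' := congrArg (Measure.map (WithLp.ofLp (p := 2))) h
  rw [Measure.map_map (by fun_prop) (by fun_prop), Measure.map_map (by fun_prop) (by fun_prop)] at h'
  have e1 : WithLp.ofLp ∘ ⇑L'' ∘ WithLp.toLp 2 = L := by
    funext x; simp [L'', L']
  have e2 : (WithLp.ofLp ∘ WithLp.toLp 2 : (κ → ℝ) → (κ → ℝ)) = id := rfl
  rw [e1, e2, Measure.map_id] at h'
  exact h'

namespace IsStdGaussian

variable {E F : Type*} [AddCommGroup E] [Module ℝ E] [MeasurableSpace E]
  [AddCommGroup F] [Module ℝ F] [MeasurableSpace F] {ι κ : Type} [Fintype ι] [Fintype κ]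
  {N : E → ℝ} {M : F → ℝ} {μ : Measure E} {ν : Measure F}

theorem isProbabilityMeasure (h : IsStdGaussian ι N μ) : IsProbabilityMeasure μ := by
  obtain ⟨e, he, -, rfl⟩ := h
  exact Measure.isProbabilityMeasure_map he.aemeasurable

/-- Linear isometries between spaces of equal dimension preserve standard Gaussian measures. -/
theorem measurePreserving (hμ : IsStdGaussian ι N μ) (hν : IsStdGaussian κ M ν) {L : E → F}
    (hadd : ∀ x y, L (x + y) = L x + L y) (hsmul : ∀ (c : ℝ) x, L (c • x) = c • L x)
    (hm : Measurable L) (hL : ∀ x, M (L x) = N x) (hc : Fintype.card ι = Fintype.card κ) :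
    MeasurePreserving L μ ν := by
  obtain ⟨e, he, hN, rfl⟩ := hμ
  obtain ⟨f, hf, hM, rfl⟩ := hν
  refine ⟨hm, ?_⟩
  let T : E →ₗ[ℝ] F := { toFun := L, map_add' := hadd, map_smul' := hsmul }
  let S : (ι → ℝ) →ₗ[ℝ] (κ → ℝ) := f.symm.toLinearMap ∘ₗ T ∘ₗ e.toLinearMap
  have hfS : ∀ x, f (S x) = L (e x) := fun x => by simp [S, T]
  have hS := map_pi_gaussianReal_of_sum_sq S
    (fun x => by rw [← hM, hfS, hL, hN]) hc
  have hSm : Measurable S := S.continuous_of_finiteDimensional.measurable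
  rw [Measure.map_map hm he, ← hS, Measure.map_map hf hSm]
  congr 1
  funext x
  exact (hfS x).symm

theorem map_sqrt (h : IsStdGaussian ι N μ) [Nonempty ι] (hN : Measurable N) :
    μ.map (fun x => √(N x)) = chi (Fintype.card ι) := by
  obtain ⟨e, he, hNe, rfl⟩ := h
  rw [Measure.map_map (by fun_prop) he]
  have h := map_norm_stdGaussian_eq_chi (E := EuclideanSpace ℝ ι)
  rw [finrank_euclideanSpace, ← map_pi_eq_stdGaussian,
    Measure.map_map (by fun_prop) (by fun_prop)] at h
  rw [← h]
  congr 1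
  funext x
  simp [EuclideanSpace.norm_eq, hNe]

theorem prod (hμ : IsStdGaussian ι N μ) (hν : IsStdGaussian κ M ν) :
    IsStdGaussian (ι ⊕ κ) (fun p => N p.1 + M p.2) (μ.prod ν) := by
  obtain ⟨e, he, hN, rfl⟩ := hμ
  obtain ⟨f, hf, hM, rfl⟩ := hν
  refine ⟨(LinearEquiv.sumArrowLequivProdArrow ι κ ℝ ℝ).trans (e.prodCongr f), ?_, ?_, ?_⟩
  · exact (he.comp (measurable_pi_lambda _ fun i => measurable_pi_apply _)).prodMk
      (hf.comp (measurable_pi_lambda _ fun i => measurable_pi_apply _))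
  · intro x
    simp [hN, hM, Fintype.sum_sum_type]
  · have h := (measurePreserving_sumPiEquivProdPi
      (fun _ : ι ⊕ κ => gaussianReal 0 1)).map_eq
    rw [Measure.map_prod_map _ _ he hf, ← h, Measure.map_map (by fun_prop) (by fun_prop)]
    rfl

theorem pi (hμ : IsStdGaussian ι N μ) (k : ℕ) :
    IsStdGaussian (Fin k × ι) (fun x : Fin k → E => ∑ i, N (x i))
      (Measure.pi fun _ : Fin k => μ) := by
  obtain ⟨e, he, hN, rfl⟩ := hμ
  refine ⟨(LinearEquiv.curry ℝ ℝ (Fin k) ι).trans (LinearEquiv.piCongrRight fun _ => e), ?_, ?_, ?_⟩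
  · exact measurable_pi_lambda _ fun i => he.comp <| measurable_pi_lambda _ fun j =>
      measurable_pi_apply _
  · intro x
    simp [hN, Fintype.sum_prod_type]
  · have h := Measure.infinitePi_map_curry (X := ℝ)
      (fun (_ : Fin k) (_ : ι) => gaussianReal 0 1)
    simp only [Measure.infinitePi_eq_pi] at h
    have : ∀ _ : Fin k, SigmaFinite (Measure.map e (Measure.pi fun _ : ι => gaussianReal 0 1)) :=
      fun _ => by
        have := Measure.isProbabilityMeasure_map (μ := Measure.pi fun _ : ι => gaussianReal 0 1)
          he.aemeasurable
        infer_instance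
    rw [← Measure.pi_map_pi (fun _ => he.aemeasurable), ← h,
      Measure.map_map (by fun_prop) (by fun_prop)]
    rfl

theorem of_map (hμ : IsStdGaussian ι N μ) (L : E ≃ₗ[ℝ] F) (hm : Measurable L)
    (hL : ∀ x, M (L x) = N x) : IsStdGaussian ι M (μ.map L) := by
  obtain ⟨e, he, hN, rfl⟩ := hμ
  exact ⟨e.trans L, hm.comp he, fun x => by simp [hL, hN], by
    rw [Measure.map_map hm he]; rfl⟩

end IsStdGaussian

/-! ### Bordered matrices -/

section Border

variable {R : Type*}

/-- The matrix with corner `h`, first row `r`, first column `c` and remaining block `M`. -/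
def border {m n : ℕ} (h : R) (r : Fin n → R) (c : Fin m → R) (M : Matrix (Fin m) (Fin n) R) :
    Matrix (Fin (m + 1)) (Fin (n + 1)) R :=
  Matrix.of (Fin.cons (Fin.cons h r) fun i => Fin.cons (c i) (M i))

variable {m n p : ℕ}

section

variable (h : R) (r : Fin n → R) (c : Fin m → R) (M : Matrix (Fin m) (Fin n) R)

@[simp] theorem border_zero_zero : border h r c M 0 0 = h := rfl
@[simp] theorem border_zero_succ (j : Fin n) : border h r c M 0 j.succ = r j := rfl
@[simp] theorem border_succ_zero (i : Fin m) : border h r c M i.succ 0 = c i := rfl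
@[simp] theorem border_succ_succ (i : Fin m) (j : Fin n) :
    border h r c M i.succ j.succ = M i j := rfl

end

theorem ext_border {A B : Matrix (Fin (m + 1)) (Fin (n + 1)) R} (h00 : A 0 0 = B 0 0)
    (h0 : ∀ j : Fin n, A 0 j.succ = B 0 j.succ) (h1 : ∀ i : Fin m, A i.succ 0 = B i.succ 0)
    (h11 : ∀ (i : Fin m) (j : Fin n), A i.succ j.succ = B i.succ j.succ) : A = B := by
  ext i j
  refine Fin.cases ?_ (fun i => ?_) i <;> refine Fin.cases ?_ (fun j => ?_) j
  · exact h00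
  · exact h0 j
  · exact h1 i
  · exact h11 i j

theorem border_eta (A : Matrix (Fin (m + 1)) (Fin (n + 1)) R) :
    border (A 0 0) (fun j => A 0 j.succ) (fun i => A i.succ 0)
      (A.submatrix Fin.succ Fin.succ) = A :=
  ext_border rfl (fun _ => rfl) (fun _ => rfl) fun _ _ => rfl

theorem border_mul [Ring R] (h h' : R) (r : Fin n → R) (c : Fin m → R)
    (M : Matrix (Fin m) (Fin n) R) (r' : Fin p → R) (c' : Fin n → R)
    (M' : Matrix (Fin n) (Fin p) R) :
    border h r c M * border h' r' c' M' =
      border (h * h' + r ⬝ᵥ c') (fun j => h * r' j + (r ᵥ* M') j)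
        (fun i => c i * h' + (M *ᵥ c') i) (Matrix.vecMulVec c r' + M * M') := by
  refine ext_border ?_ (fun j => ?_) (fun i => ?_) fun i j => ?_ <;>
    simp [Matrix.mul_apply, Fin.sum_univ_succ, dotProduct, Matrix.vecMul, Matrix.mulVec,
      Matrix.vecMulVec_apply]

theorem conjTranspose_border [Star R] (h : R) (r : Fin n → R) (c : Fin m → R)
    (M : Matrix (Fin m) (Fin n) R) :
    (border h r c M)ᴴ = border (star h) (star c) (star r) Mᴴ :=
  ext_border rfl (fun _ => rfl) (fun _ => rfl) fun _ _ => rfl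

theorem border_add [Add R] (h h' : R) (r r' : Fin n → R) (c c' : Fin m → R)
    (M M' : Matrix (Fin m) (Fin n) R) :
    border h r c M + border h' r' c' M' = border (h + h') (r + r') (c + c') (M + M') :=
  ext_border rfl (fun _ => rfl) (fun _ => rfl) fun _ _ => rfl

theorem border_smul {S : Type*} [SMul S R] (s : S) (h : R) (r : Fin n → R) (c : Fin m → R)
    (M : Matrix (Fin m) (Fin n) R) :
    s • border h r c M = border (s • h) (s • r) (s • c) (s • M) :=
  ext_border rfl (fun _ => rfl) (fun _ => rfl) fun _ _ => rfl

theorem border_map {S : Type*} (f : R → S) (h : R) (r : Fin n → R) (c : Fin m → R)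
    (M : Matrix (Fin m) (Fin n) R) :
    (border h r c M).map f = border (f h) (f ∘ r) (f ∘ c) (M.map f) :=
  ext_border rfl (fun _ => rfl) (fun _ => rfl) fun _ _ => rfl

theorem border_one_zero_zero_one [Zero R] [One R] :
    border (1 : R) 0 0 (1 : Matrix (Fin n) (Fin n) R) = 1 := by
  refine ext_border ?_ (fun j => ?_) (fun i => ?_) fun i j => ?_
  · simp
  · simp [(Fin.succ_ne_zero j).symm]
  · simp
  · simp [Matrix.one_apply]

theorem border_mem_unitary [Ring R] [StarRing R] {U : Matrix (Fin n) (Fin n) R}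
    (hU : U ∈ unitary (Matrix (Fin n) (Fin n) R)) :
    border 1 0 0 U ∈ unitary (Matrix (Fin (n + 1)) (Fin (n + 1)) R) := by
  rw [Unitary.mem_iff] at hU ⊢
  rw [Matrix.star_eq_conjTranspose] at *
  have h0 : (fun _ : Fin n => (0 : R)) = 0 := rfl
  constructor <;> simp [conjTranspose_border, border_mul, hU.1, hU.2, h0, border_one_zero_zero_one,
    -Matrix.vecMulVec_zero, Matrix.vecMulVec_zero]

end Border

/-! ### Measurability of matrix operations -/

section Measurability

variable {α R : Type*} [MeasurableSpace α] [MeasurableSpace R] {m n p : Type*}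

theorem measurable_matrix_of {f : α → Matrix m n R} (h : ∀ i j, Measurable fun x => f x i j) :
    Measurable f :=
  measurable_pi_lambda _ fun i => measurable_pi_lambda _ fun j => h i j

theorem _root_.Measurable.matrix_apply {f : α → Matrix m n R} (h : Measurable f) (i : m) (j : n) :
    Measurable fun x => f x i j :=
  measurable_pi_iff.1 (measurable_pi_iff.1 h i) j

theorem _root_.Measurable.matrix_mul [Ring R] [MeasurableAdd₂ R] [MeasurableMul₂ R] [Fintype n]
    {f : α → Matrix m n R} {g : α → Matrix n p R} (hf : Measurable f) (hg : Measurable g) :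
    Measurable fun x => f x * g x := by
  refine measurable_matrix_of fun i j => ?_
  simp only [Matrix.mul_apply]
  exact Finset.measurable_fun_sum _ fun k _ => (hf.matrix_apply i k).mul (hg.matrix_apply k j)

theorem _root_.Measurable.matrix_mulVec [Ring R] [MeasurableAdd₂ R] [MeasurableMul₂ R] [Fintype n]
    {f : α → Matrix m n R} {g : α → n → R} (hf : Measurable f) (hg : Measurable g) :
    Measurable fun x => f x *ᵥ g x := by
  refine measurable_pi_lambda _ fun i => ?_
  simp only [Matrix.mulVec, dotProduct]
  exact Finset.measurable_fun_sum _ fun k _ => (hf.matrix_apply i k).mul (measurable_pi_iff.1 hg k)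

theorem _root_.Measurable.matrix_add [Add R] [MeasurableAdd₂ R]
    {f g : α → Matrix m n R} (hf : Measurable f) (hg : Measurable g) :
    Measurable fun x => f x + g x :=
  measurable_matrix_of fun i j => (hf.matrix_apply i j).add (hg.matrix_apply i j)

theorem _root_.Measurable.matrix_conjTranspose [Star R] (hs : Measurable (star : R → R))
    {f : α → Matrix m n R} (hf : Measurable f) :
    Measurable fun x => (f x)ᴴ :=
  measurable_matrix_of fun i j => hs.comp (hf.matrix_apply j i)

theorem _root_.Measurable.matrix_transpose {f : α → Matrix m n R} (hf : Measurable f) :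
    Measurable fun x => (f x)ᵀ :=
  measurable_matrix_of fun i j => hf.matrix_apply j i

theorem _root_.Measurable.border {m n : ℕ} {h : α → R} {r : α → Fin n → R} {c : α → Fin m → R}
    {M : α → Matrix (Fin m) (Fin n) R} (hh : Measurable h) (hr : Measurable r) (hc : Measurable c)
    (hM : Measurable M) : Measurable fun x => border (h x) (r x) (c x) (M x) := by
  refine measurable_matrix_of fun i j => ?_
  refine Fin.cases ?_ (fun i => ?_) i <;> refine Fin.cases ?_ (fun j => ?_) j
  · exact hh
  · exact measurable_pi_iff.1 hr j
  · exact measurable_pi_iff.1 hc i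
  · exact hM.matrix_apply i j

end Measurability

/-! ### The scalar fields -/

/-- A real normed division algebra with involution, with real self-adjoint elements and
positive definite norm form, together with the standard Gaussian measure. It covers `ℝ`, `ℂ`
and `ℍ`. -/
class GaussianScalars (K : Type*) [NormedDivisionRing K] [NormedAlgebra ℝ K] [StarRing K]
    [MeasurableSpace K] where
  /-- The real part. -/
  re : K →ₗ[ℝ] ℝ
  /-- The real dimension. -/
  dim : ℕ
  /-- The standard Gaussian measure. -/
  gauss : Measure K
  dim_pos : 0 < dim
  measurable_re : Measurable re
  re_star : ∀ x : K, re (star x) = re x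
  re_algebraMap : ∀ r : ℝ, re (algebraMap ℝ K r) = r
  star_mul_self_eq : ∀ x : K, star x * x = algebraMap ℝ K (‖x‖ ^ 2)
  eq_algebraMap_re : ∀ x : K, star x = x → x = algebraMap ℝ K (re x)
  isStdGaussian_gauss : IsStdGaussian (Fin dim) (fun x : K => ‖x‖ ^ 2) gauss
  map_re_gauss : gauss.map re = gaussianReal 0 1

open GaussianScalars

/-- The Euclidean norm of a vector. -/
def vecNorm {K ι : Type*} [Norm K] [Fintype ι] (v : ι → K) : ℝ := √(∑ i, ‖v i‖ ^ 2)

section Householder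

variable {K : Type*} [NormedDivisionRing K] [NormedAlgebra ℝ K] [StarRing K]
  [StarModule ℝ K] [NormedStarGroup K] [MeasurableSpace K] [GaussianScalars K]

theorem star_algebraMap_real (r : ℝ) : star (algebraMap ℝ K r) = algebraMap ℝ K r := by
  rw [← algebraMap_star_comm]; simp

theorem vecNorm_nonneg {ι : Type*} [Fintype ι] (v : ι → K) : 0 ≤ vecNorm v := Real.sqrt_nonneg _

theorem vecNorm_sq {ι : Type*} [Fintype ι] (v : ι → K) : vecNorm v ^ 2 = ∑ i, ‖v i‖ ^ 2 :=
  Real.sq_sqrt (by positivity)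

theorem star_dotProduct_self {ι : Type*} [Fintype ι] (v : ι → K) :
    star v ⬝ᵥ v = algebraMap ℝ K (vecNorm v ^ 2) := by
  simp [vecNorm_sq, dotProduct, star_mul_self_eq]

theorem eq_zero_of_vecNorm_eq_zero {ι : Type*} [Fintype ι] {v : ι → K} (h : vecNorm v = 0) :
    v = 0 := by
  have h2 : ∑ i, ‖v i‖ ^ 2 = 0 := by rw [← vecNorm_sq, h]; simp
  rw [Finset.sum_eq_zero_iff_of_nonneg (fun _ _ => by positivity)] at h2
  funext i
  simpa using h2 i (Finset.mem_univ i)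

theorem vecNorm_mulVec_of_mem_unitary {ι : Type*} [Fintype ι] [DecidableEq ι] {U : Matrix ι ι K}
    (hU : U ∈ unitary (Matrix ι ι K)) (v : ι → K) : vecNorm (U *ᵥ v) = vecNorm v := by
  have h := star_dotProduct_self (U *ᵥ v)
  rw [Matrix.star_mulVec, Matrix.dotProduct_mulVec, Matrix.vecMul_vecMul,
    ← Matrix.star_eq_conjTranspose, (Unitary.mem_iff.1 hU).1, Matrix.vecMul_one,
    star_dotProduct_self] at h
  have h := (algebraMap ℝ K).injective h
  exact ((sq_eq_sq₀ (vecNorm_nonneg _) (vecNorm_nonneg _)).1 h).symm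

theorem vecNorm_star {ι : Type*} [Fintype ι] (v : ι → K) : vecNorm (star v) = vecNorm v := by
  simp [vecNorm]

variable {k : ℕ}

open Classical in
/-- The unitary scalar which makes a given scalar real and nonnegative. -/
def phase (x : K) : K := if x = 0 then 1 else (‖x‖⁻¹ : ℝ) • star x

theorem phase_mul (x : K) : phase x * x = algebraMap ℝ K ‖x‖ := by
  unfold phase
  split_ifs with h
  · simp [h]
  · rw [smul_mul_assoc, star_mul_self_eq, Algebra.smul_def, ← map_mul]
    congr 1
    have : ‖x‖ ≠ 0 := norm_ne_zero_iff.2 h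
    field_simp

theorem phase_norm (x : K) : ‖phase x‖ = 1 := by
  unfold phase
  split_ifs with h
  · simp
  · have : ‖x‖ ≠ 0 := norm_ne_zero_iff.2 h
    rw [norm_smul, norm_star]
    simp [this]

theorem star_phase_mul_phase (x : K) : star (phase x) * phase x = 1 := by
  rw [star_mul_self_eq, phase_norm]; simp

theorem phase_mul_star_phase (x : K) : phase x * star (phase x) = 1 := by
  have := star_mul_self_eq (star (phase x))
  rwa [star_star, norm_star, phase_norm, one_pow, map_one] at this

/-- The diagonal unitary matrix which makes the first coordinate of `v` nonnegative. -/
def phaseMatrix (v : Fin (k + 1) → K) : Matrix (Fin (k + 1)) (Fin (k + 1)) K :=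
  border (phase (v 0)) 0 0 1

/-- The Householder reflection in the hyperplane orthogonal to `w`. -/
def reflection {ι : Type*} [Fintype ι] [DecidableEq ι] (w : ι → K) : Matrix ι ι K :=
  1 - (2 / vecNorm w ^ 2 : ℝ) • Matrix.vecMulVec w (star w)

/-- A unitary matrix which maps `v` to a nonnegative multiple of the first basis vector. -/
def householder (v : Fin (k + 1) → K) : Matrix (Fin (k + 1)) (Fin (k + 1)) K :=
  reflection (phaseMatrix v *ᵥ v - Pi.single 0 (algebraMap ℝ K (vecNorm v))) * phaseMatrix v

theorem phaseMatrix_mem_unitary (v : Fin (k + 1) → K) :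
    phaseMatrix v ∈ unitary (Matrix (Fin (k + 1)) (Fin (k + 1)) K) := by
  have h0 : (fun _ : Fin k => (0 : K)) = 0 := rfl
  rw [Unitary.mem_iff, Matrix.star_eq_conjTranspose, phaseMatrix]
  constructor <;> simp [conjTranspose_border, border_mul, star_phase_mul_phase,
    phase_mul_star_phase, h0, border_one_zero_zero_one]

/-- In the middle of the product stands `w* w`, a real number and therefore central, even over the
quaternions. -/
theorem vecMulVec_star_mul_self {ι : Type*} [Fintype ι] (w : ι → K) :
    Matrix.vecMulVec w (star w) * Matrix.vecMulVec w (star w) =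
      (vecNorm w ^ 2) • Matrix.vecMulVec w (star w) := by
  rw [Matrix.vecMulVec_mul_vecMulVec, star_dotProduct_self]
  ext i j
  simp only [Matrix.vecMulVec_apply, Matrix.smul_apply, Pi.smul_apply, smul_eq_mul,
    Algebra.smul_def]
  rw [← mul_assoc, ← Algebra.commutes _ (w i), mul_assoc]

theorem reflection_mem_unitary {ι : Type*} [Fintype ι] [DecidableEq ι] (w : ι → K) :
    reflection w ∈ unitary (Matrix ι ι K) := by
  have hs : star (reflection w) = reflection w := by
    rw [reflection, star_sub, star_one, star_smul, Matrix.star_eq_conjTranspose,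
      Matrix.conjTranspose_vecMulVec, star_star, star_trivial]
  have h2 : reflection w * reflection w = 1 := by
    rw [reflection]
    set P := Matrix.vecMulVec w (star w) with hP
    have hPP : P * P = (vecNorm w ^ 2) • P := vecMulVec_star_mul_self w
    rw [sub_mul, mul_sub, mul_sub, one_mul, mul_one, one_mul, smul_mul_smul_comm, hPP, smul_smul]
    -- For `w = 0` the coefficient `2 / 0` is zero by convention and the reflection is the identity,
    -- so unitarity needs no assumption on `w`.
    rcases eq_or_ne (vecNorm w) 0 with h | h
    · simp [h]
    · have : (2 / vecNorm w ^ 2) * (2 / vecNorm w ^ 2) * vecNorm w ^ 2 = 2 * (2 / vecNorm w ^ 2) := by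
        field_simp
      rw [this]
      module
  rw [Unitary.mem_iff, hs]
  exact ⟨h2, h2⟩

theorem householder_mem_unitary (v : Fin (k + 1) → K) :
    householder v ∈ unitary (Matrix (Fin (k + 1)) (Fin (k + 1)) K) :=
  mul_mem (reflection_mem_unitary _) (phaseMatrix_mem_unitary v)

theorem phaseMatrix_mulVec (v : Fin (k + 1) → K) :
    phaseMatrix v *ᵥ v = Fin.cons (algebraMap ℝ K ‖v 0‖) (Fin.tail v) := by
  funext i
  refine Fin.cases ?_ (fun i => ?_) i
  · simp [phaseMatrix, Matrix.mulVec, dotProduct, Fin.sum_univ_succ, phase_mul]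
  · simp [phaseMatrix, Matrix.mulVec, dotProduct, Fin.sum_univ_succ, Matrix.one_apply, Fin.tail]

/-- After the phase, `u` and `e` have equal norm and a real inner product, since the first
coordinate of `u` is real. Hence the inner product of `u - e` with `u` is half of `‖u - e‖²`, and
the reflection orthogonal to `u - e` sends `u` to `u - (u - e) = e`. -/
theorem householder_mulVec (v : Fin (k + 1) → K) :
    householder v *ᵥ v = Pi.single 0 (algebraMap ℝ K (vecNorm v)) := by
  have hv : vecNorm v ^ 2 = ‖v 0‖ ^ 2 + ∑ i : Fin k, ‖v i.succ‖ ^ 2 := by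
    rw [vecNorm_sq, Fin.sum_univ_succ]
  rw [householder, ← Matrix.mulVec_mulVec, phaseMatrix_mulVec]
  set u : Fin (k + 1) → K := Fin.cons (algebraMap ℝ K ‖v 0‖) (Fin.tail v) with hu
  set e : Fin (k + 1) → K := Pi.single 0 (algebraMap ℝ K (vecNorm v)) with he
  have hw : vecNorm (u - e) ^ 2 = 2 * (vecNorm v ^ 2 - vecNorm v * ‖v 0‖) := by
    rw [vecNorm_sq, Fin.sum_univ_succ]
    have h0 : ‖(u - e) 0‖ ^ 2 = (‖v 0‖ - vecNorm v) ^ 2 := by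
      simp only [hu, he, Pi.sub_apply, Fin.cons_zero, Pi.single_eq_same]
      rw [← map_sub, norm_algebraMap', Real.norm_eq_abs, sq_abs]
    have h1 : ∀ i : Fin k, (u - e) i.succ = v i.succ := by
      intro i; simp [hu, he, Fin.tail, Fin.succ_ne_zero]
    simp_rw [h0, h1]
    linarith
  have hd : star (u - e) ⬝ᵥ u = algebraMap ℝ K (vecNorm v ^ 2 - vecNorm v * ‖v 0‖) := by
    rw [star_sub, sub_dotProduct, star_dotProduct_self]
    have h1 : vecNorm u ^ 2 = vecNorm v ^ 2 := by
      rw [hv, vecNorm_sq, Fin.sum_univ_succ]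
      simp [hu, Fin.tail]
    have h2 : star e ⬝ᵥ u = algebraMap ℝ K (vecNorm v * ‖v 0‖) := by
      rw [dotProduct, Fin.sum_univ_succ]
      simp [hu, he, Fin.succ_ne_zero, star_algebraMap_real]
    rw [h1, h2, map_sub]
  rw [reflection, Matrix.sub_mulVec, Matrix.one_mulVec, Matrix.smul_mulVec]
  have hmv : Matrix.vecMulVec (u - e) (star (u - e)) *ᵥ u =
      (vecNorm v ^ 2 - vecNorm v * ‖v 0‖) • (u - e) := by
    funext i
    have : (Matrix.vecMulVec (u - e) (star (u - e)) *ᵥ u) i =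
        (u - e) i * (star (u - e) ⬝ᵥ u) := by
      simp [Matrix.mulVec, dotProduct, Matrix.vecMulVec_apply, Finset.mul_sum, mul_assoc]
    rw [this, hd, ← Algebra.commutes, Pi.smul_apply, Algebra.smul_def]
  rw [hmv, smul_smul, hw]
  -- This quantity is half of `‖u - e‖²`. If it vanishes then `u = e` and the reflection has nothing
  -- to move.
  rcases eq_or_ne (vecNorm v ^ 2 - vecNorm v * ‖v 0‖) 0 with h | h
  · have : u - e = 0 := eq_zero_of_vecNorm_eq_zero (by rw [h] at hw; simpa using hw)
    rw [h]
    simpa [sub_eq_zero] using this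
  · have : 2 / (2 * (vecNorm v ^ 2 - vecNorm v * ‖v 0‖)) * (vecNorm v ^ 2 - vecNorm v * ‖v 0‖) = 1 := by
      rw [div_mul_eq_mul_div, div_self (mul_ne_zero two_ne_zero h)]
    rw [this, one_smul, sub_sub_cancel]

end Householder

section Tridiagonalization

variable {K : Type*} [NormedDivisionRing K] [NormedAlgebra ℝ K] [StarRing K]
  [StarModule ℝ K] [NormedStarGroup K] [MeasurableSpace K] [GaussianScalars K]

/-! ### Householder tridiagonalization -/

/-- The first column of a matrix without its first entry. -/
def colTail {m n : ℕ} (H : Matrix (Fin (m + 1)) (Fin (n + 1)) K) : Fin m → K :=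
  fun i => H i.succ 0

/-- The block that remains when the first column of `H` has been brought to tridiagonal form. -/
def deflate {k : ℕ} (H : Matrix (Fin (k + 2)) (Fin (k + 2)) K) :
    Matrix (Fin (k + 1)) (Fin (k + 1)) K :=
  householder (colTail H) * H.submatrix Fin.succ Fin.succ * (householder (colTail H))ᴴ

/-- The tridiagonal form of a Hermitian matrix, computed by Householder's algorithm. -/
def tridiagonal : ∀ k : ℕ, Matrix (Fin (k + 1)) (Fin (k + 1)) K →
    Matrix (Fin (k + 1)) (Fin (k + 1)) ℝ
  | 0, H => Matrix.of fun _ _ => re (H 0 0)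
  | k + 1, H => border (re (H 0 0)) (Pi.single 0 (vecNorm (colTail H)))
      (Pi.single 0 (vecNorm (colTail H))) (tridiagonal k (deflate H))

/-- The unitary matrix which brings a Hermitian matrix to tridiagonal form. -/
def tridiagonalizer : ∀ k : ℕ, Matrix (Fin (k + 1)) (Fin (k + 1)) K →
    Matrix (Fin (k + 1)) (Fin (k + 1)) K
  | 0, _ => 1
  | k + 1, H => border 1 0 0 (tridiagonalizer k (deflate H) * householder (colTail H))

theorem tridiagonalizer_mem_unitary (k : ℕ) (H : Matrix (Fin (k + 1)) (Fin (k + 1)) K) :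
    tridiagonalizer k H ∈ unitary (Matrix (Fin (k + 1)) (Fin (k + 1)) K) := by
  induction k with
  | zero => exact one_mem _
  | succ k ih => exact border_mem_unitary (mul_mem (ih _) (householder_mem_unitary _))

/-- All the reflections act on coordinates after the first. This is what lets the perturbation `l
E₁₁` survive the tridiagonalization. -/
theorem tridiagonalizer_mulVec_single (k : ℕ) (H : Matrix (Fin (k + 1)) (Fin (k + 1)) K) (x : K) :
    tridiagonalizer k H *ᵥ Pi.single 0 x = Pi.single 0 x := by
  cases k with
  | zero => rw [tridiagonalizer, Matrix.one_mulVec]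
  | succ k =>
    funext i
    rw [tridiagonalizer, Matrix.mulVec, dotProduct, Fin.sum_univ_succ]
    refine Fin.cases ?_ (fun i => ?_) i <;> simp [Fin.succ_ne_zero]

theorem single_vecMul_conjTranspose_tridiagonalizer (k : ℕ)
    (H : Matrix (Fin (k + 1)) (Fin (k + 1)) K) (x : K) :
    Pi.single 0 x ᵥ* (tridiagonalizer k H)ᴴ = Pi.single 0 x := by
  have h := congrArg star (tridiagonalizer_mulVec_single k H (star x))
  rw [Matrix.star_mulVec] at h
  have hs : star (Pi.single (0 : Fin (k + 1)) (star x) : Fin (k + 1) → K) = Pi.single 0 x := by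
    rw [← Pi.single_star, star_star]
  rwa [hs] at h

theorem isHermitian_conj {ι κ : Type*} [Fintype ι] {H : Matrix ι ι K} (hH : H.IsHermitian)
    (U : Matrix κ ι K) : (U * H * Uᴴ).IsHermitian := by
  simp [Matrix.IsHermitian, Matrix.conjTranspose_mul, hH.eq, Matrix.mul_assoc]

theorem isHermitian_deflate {k : ℕ} {H : Matrix (Fin (k + 2)) (Fin (k + 2)) K}
    (hH : H.IsHermitian) : (deflate H).IsHermitian :=
  isHermitian_conj (hH.submatrix _) _

/-- Conjugating the block matrix with column `v` and block `M` by `diag(1, P)` gives column `P v`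
and block `P M P*`. Here `P` is the Householder matrix of `v` followed by the tridiagonalizer of the
deflated block. So `P v = ‖v‖ e₁`, and `P M P*` is covered by induction. Diagonal entries are real
because self-adjoint scalars are. -/
theorem tridiagonalizer_conj (k : ℕ) {H : Matrix (Fin (k + 1)) (Fin (k + 1)) K}
    (hH : H.IsHermitian) :
    tridiagonalizer k H * H * (tridiagonalizer k H)ᴴ =
      (tridiagonal k H).map (algebraMap ℝ K) := by
  induction k with
  | zero =>
    ext i j
    fin_cases i; fin_cases j
    simpa [tridiagonalizer, tridiagonal] using eq_algebraMap_re _ (hH.apply 0 0)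
  | succ k ih =>
    set v : Fin (k + 1) → K := colTail H with hv
    set Q := householder v with hQ
    have hrow : (fun j : Fin (k + 1) => H 0 j.succ) = star v := by
      funext j; exact (hH.apply 0 j.succ).symm
    have hW : (tridiagonalizer k (deflate H) * Q) *ᵥ v =
        Pi.single 0 (algebraMap ℝ K (vecNorm v)) := by
      rw [← Matrix.mulVec_mulVec, hQ, householder_mulVec, tridiagonalizer_mulVec_single]
    have hW' : star v ᵥ* (tridiagonalizer k (deflate H) * Q)ᴴ =
        Pi.single 0 (algebraMap ℝ K (vecNorm v)) := by
      rw [← Matrix.star_mulVec, hW, ← Pi.single_star, star_algebraMap_real]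
    have hdef : tridiagonalizer k (deflate H) * Q * H.submatrix Fin.succ Fin.succ *
        (tridiagonalizer k (deflate H) * Q)ᴴ = (tridiagonal k (deflate H)).map (algebraMap ℝ K) := by
      rw [← ih (isHermitian_deflate hH)]
      have hd : deflate H = Q * H.submatrix Fin.succ Fin.succ * Qᴴ := rfl
      generalize deflate H = D at hd ⊢
      generalize tridiagonalizer k D = W
      rw [hd]
      simp only [Matrix.conjTranspose_mul, Matrix.mul_assoc]
    rw [tridiagonalizer, tridiagonal, ← hv, ← hQ, border_map, ← hdef]
    generalize tridiagonalizer k (deflate H) * Q = P at hW hW' ⊢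
    have hc : ∀ x : ℝ, algebraMap ℝ K ∘ Pi.single (0 : Fin (k + 1)) x =
        Pi.single 0 (algebraMap ℝ K x) := fun x => by
      funext i
      exact (Pi.apply_single (fun _ => algebraMap ℝ K) (fun _ => map_zero _) 0 x i)
    rw [hc]
    have heta := border_eta H
    rw [hrow, show (fun i => H i.succ 0) = v from rfl] at heta
    conv_lhs => rw [← heta, conjTranspose_border, border_mul, border_mul]
    congr 1
    · simp only [star_one, star_zero, mul_one, zero_dotProduct, dotProduct_zero, one_mul, add_zero]
      exact eq_algebraMap_re _ (hH.apply 0 0)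
    · funext j
      rw [← hW']
      simp
      rfl
    · funext i
      rw [← hW]
      simp
    · simp

/-- The algorithm merely copies the real part of the corner entry: neither the reflection nor the
deflated block depends on it. The Wishart recursion uses this to carry along the term `‖r‖² E₁₁`. -/
theorem tridiagonal_add_single (k : ℕ) (H : Matrix (Fin (k + 1)) (Fin (k + 1)) K) (s : ℝ) :
    tridiagonal k (H + Matrix.single 0 0 (algebraMap ℝ K s)) =
      tridiagonal k H + Matrix.single 0 0 s := by
  cases k with
  | zero =>
    ext i j
    fin_cases i; fin_cases j
    simp [tridiagonal, re_algebraMap]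
  | succ k =>
    have hcol : colTail (H + Matrix.single 0 0 (algebraMap ℝ K s)) = colTail H := by
      funext i
      simp [colTail, (Fin.succ_ne_zero i).symm]
    have hsub : (H + Matrix.single 0 0 (algebraMap ℝ K s)).submatrix Fin.succ Fin.succ =
        H.submatrix Fin.succ Fin.succ := by
      ext i j
      simp [(Fin.succ_ne_zero i).symm]
    have hd : deflate (H + Matrix.single 0 0 (algebraMap ℝ K s)) = deflate H := by
      rw [deflate, deflate, hcol, hsub]
    rw [tridiagonal, tridiagonal, hcol, hd]
    refine ext_border ?_ (fun j => ?_) (fun i => ?_) fun i j => ?_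
    · simp [re_algebraMap]
    · simp [(Fin.succ_ne_zero j).symm]
    · simp [(Fin.succ_ne_zero i).symm]
    · simp [(Fin.succ_ne_zero j).symm]

theorem tridiagonal_zero (k : ℕ) :
    tridiagonal k (0 : Matrix (Fin (k + 1)) (Fin (k + 1)) K) = 0 := by
  induction k with
  | zero => ext i j; simp [tridiagonal]
  | succ k ih =>
    have hd : deflate (0 : Matrix (Fin (k + 2)) (Fin (k + 2)) K) = 0 := by
      simp [deflate]
    have hv : vecNorm (colTail (0 : Matrix (Fin (k + 2)) (Fin (k + 2)) K)) = 0 := by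
      simp [vecNorm, colTail]
    rw [tridiagonal, hd, ih, hv]
    refine ext_border ?_ (fun j => ?_) (fun i => ?_) fun i j => ?_ <;> simp

/-! ### Measurability of the algorithm -/

section

variable [BorelSpace K] [SecondCountableTopology K] {α : Type*} [MeasurableSpace α]

theorem measurable_star_scalar : Measurable (star : K → K) := continuous_star.measurable

theorem measurable_algebraMap_real : Measurable (algebraMap ℝ K) :=
  (algebraMapCLM ℝ K).continuous.measurable

theorem measurable_vecNorm {ι : Type*} [Fintype ι] : Measurable (vecNorm : (ι → K) → ℝ) := by
  unfold vecNorm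
  fun_prop

theorem measurable_phase : Measurable (phase : K → K) := by
  unfold phase
  refine Measurable.ite (measurableSet_singleton 0) measurable_const ?_
  exact measurable_norm.inv.smul measurable_star_scalar

theorem measurable_phaseMatrix {k : ℕ} :
    Measurable (phaseMatrix : (Fin (k + 1) → K) → Matrix (Fin (k + 1)) (Fin (k + 1)) K) :=
  Measurable.border (measurable_phase.comp (measurable_pi_apply 0)) measurable_const
    measurable_const measurable_const

theorem measurable_reflection {ι : Type*} [Fintype ι] [DecidableEq ι] :
    Measurable (reflection : (ι → K) → Matrix ι ι K) := by
  refine measurable_matrix_of fun i j => ?_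
  have hs : Measurable (star : K → K) := measurable_star_scalar
  have hv : Measurable (vecNorm : (ι → K) → ℝ) := measurable_vecNorm
  simp only [reflection, Matrix.sub_apply, Matrix.smul_apply, Matrix.vecMulVec_apply, Pi.star_apply]
  exact measurable_const.sub (((hv.pow_const 2).const_div 2).smul
    ((measurable_pi_apply i).mul (hs.comp (measurable_pi_apply j))))

theorem measurable_householder {k : ℕ} :
    Measurable (householder : (Fin (k + 1) → K) → Matrix (Fin (k + 1)) (Fin (k + 1)) K) := by
  unfold householder
  refine (measurable_reflection.comp ?_).matrix_mul measurable_phaseMatrix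
  refine (measurable_phaseMatrix.matrix_mulVec measurable_id).sub ?_
  refine measurable_pi_lambda _ fun i => ?_
  simp only [Pi.single_apply]
  split_ifs
  · exact measurable_algebraMap_real.comp measurable_vecNorm
  · exact measurable_const

theorem measurable_colTail {m n : ℕ} :
    Measurable (colTail : Matrix (Fin (m + 1)) (Fin (n + 1)) K → _) :=
  measurable_pi_lambda _ fun i => measurable_id.matrix_apply i.succ 0

theorem _root_.Measurable.matrix_submatrix {m n p q : Type*} {f : α → Matrix m n K}
    (hf : Measurable f) (r : p → m) (c : q → n) : Measurable fun x => (f x).submatrix r c :=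
  measurable_matrix_of fun i j => hf.matrix_apply (r i) (c j)

theorem measurable_conj {k : ℕ} {U H : α → Matrix (Fin k) (Fin k) K} (hU : Measurable U)
    (hH : Measurable H) : Measurable fun x => U x * H x * (U x)ᴴ :=
  (hU.matrix_mul hH).matrix_mul (Measurable.matrix_conjTranspose measurable_star_scalar hU)

theorem measurable_deflate {k : ℕ} :
    Measurable (deflate : Matrix (Fin (k + 2)) (Fin (k + 2)) K → _) :=
  measurable_conj (measurable_householder.comp measurable_colTail)
    (measurable_id.matrix_submatrix _ _)

theorem measurable_pi_single_zero {R : Type*} [MeasurableSpace R] [Zero R] {k : ℕ} :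
    Measurable fun x : R => (Pi.single 0 x : Fin (k + 1) → R) := by
  refine measurable_pi_lambda _ fun i => ?_
  simp only [Pi.single_apply]
  split_ifs
  · exact measurable_id
  · exact measurable_const

theorem measurable_tridiagonal (k : ℕ) :
    Measurable (tridiagonal k : Matrix (Fin (k + 1)) (Fin (k + 1)) K → _) := by
  induction k with
  | zero =>
    exact measurable_matrix_of fun i j => measurable_re.comp (measurable_id.matrix_apply 0 0)
  | succ k ih =>
    have h := (measurable_pi_single_zero (k := k)).comp (measurable_vecNorm.comp
      (measurable_colTail (K := K) (m := k + 1) (n := k + 1)))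
    exact Measurable.border (measurable_re.comp (measurable_id.matrix_apply 0 0)) h h
      (ih.comp measurable_deflate)

theorem measurable_tridiagonalizer (k : ℕ) :
    Measurable (tridiagonalizer k : Matrix (Fin (k + 1)) (Fin (k + 1)) K → _) := by
  induction k with
  | zero => exact measurable_const
  | succ k ih =>
    exact Measurable.border measurable_const measurable_const measurable_const
      ((ih.comp measurable_deflate).matrix_mul
        (measurable_householder.comp measurable_colTail))

end

/-! ### Rank one positive matrices -/

theorem hsNorm_conjTranspose {n : ℕ} (G : Matrix (Fin n) (Fin n) K) : hsNorm Gᴴ = hsNorm G := by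
  unfold hsNorm
  rw [Finset.sum_comm]
  simp

theorem hsNorm_unitary_mul {n : ℕ} {U : Matrix (Fin n) (Fin n) K}
    (hU : U ∈ unitary (Matrix (Fin n) (Fin n) K)) (G : Matrix (Fin n) (Fin n) K) :
    hsNorm (U * G) = hsNorm G := by
  unfold hsNorm
  congr 1
  rw [Finset.sum_comm, Finset.sum_comm (f := fun j k => ‖G j k‖ ^ 2)]
  refine Finset.sum_congr rfl fun j _ => ?_
  have h := vecNorm_mulVec_of_mem_unitary hU fun i => G i j
  have h2 := congrArg (· ^ 2) h
  simp only [vecNorm_sq] at h2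
  exact h2

theorem hsNorm_unitary_conj {n : ℕ} {U : Matrix (Fin n) (Fin n) K}
    (hU : U ∈ unitary (Matrix (Fin n) (Fin n) K)) (G : Matrix (Fin n) (Fin n) K) :
    hsNorm (U * G * Uᴴ) = hsNorm G := by
  rw [← hsNorm_conjTranspose, Matrix.conjTranspose_mul, Matrix.conjTranspose_conjTranspose,
    hsNorm_unitary_mul hU, hsNorm_conjTranspose, hsNorm_unitary_mul hU]

theorem hsNorm_single {k : ℕ} {r : ℝ} (hr : 0 ≤ r) :
    hsNorm (Matrix.single 0 0 (algebraMap ℝ K r) : Matrix (Fin (k + 1)) (Fin (k + 1)) K) = r := by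
  unfold hsNorm
  rw [Fin.sum_univ_succ, Fin.sum_univ_succ]
  simp [(Fin.succ_ne_zero _).symm, abs_of_nonneg hr, norm_algebraMap']
  rw [Real.sqrt_sq hr]

/-- Hermitian symmetry removes the rest of the first row, and testing positivity on the first basis
vector makes the corner a nonnegative real, which must then be the Hilbert-Schmidt norm. -/
theorem eq_single_of_isPositive {k : ℕ} {A : Matrix (Fin (k + 1)) (Fin (k + 1)) K}
    (hA : IsPositive A) (h : ∀ i ≠ 0, ∀ j, A i j = 0) :
    A = Matrix.single 0 0 (algebraMap ℝ K (hsNorm A)) := by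
  obtain ⟨r, hr, h00⟩ := hA.2 (Pi.single 0 1)
  have hA00 : A 0 0 = algebraMap ℝ K r := by
    rw [← h00, ← Pi.single_star]
    simp
  have : A = Matrix.single 0 0 (algebraMap ℝ K r) := by
    refine ext_border ?_ (fun j => ?_) (fun i => ?_) fun i j => ?_
    · simp [hA00]
    · rw [← hA.1.apply 0 j.succ, h _ (Fin.succ_ne_zero j)]
      simp [(Fin.succ_ne_zero j).symm]
    · rw [h _ (Fin.succ_ne_zero i)]
      simp [(Fin.succ_ne_zero i).symm]
    · rw [h _ (Fin.succ_ne_zero i)]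
      simp [(Fin.succ_ne_zero i).symm]
  have hn : hsNorm A = r := by rw [this, hsNorm_single hr]
  rw [hn, this]

theorem IsPositive.conj {n : ℕ} {A : Matrix (Fin n) (Fin n) K} (hA : IsPositive A)
    (U : Matrix (Fin n) (Fin n) K) : IsPositive (U * A * Uᴴ) := by
  refine ⟨isHermitian_conj hA.1 U, fun x => ?_⟩
  obtain ⟨r, hr, h⟩ := hA.2 (Uᴴ *ᵥ x)
  refine ⟨r, hr, ?_⟩
  rw [← h, Matrix.star_mulVec, Matrix.conjTranspose_conjTranspose, ← Matrix.mulVec_mulVec,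
    ← Matrix.mulVec_mulVec, Matrix.dotProduct_mulVec]

/-- Every column is a right multiple of one generator `u` of the column space; the scalars from
`Kᵐᵒᵖ` act by multiplication on the right. -/
theorem exists_vecMulVec_of_rightRank_eq_one {n : ℕ} {G : Matrix (Fin n) (Fin n) K}
    (h : rightRank G = 1) : ∃ u t : Fin n → K, G = Matrix.vecMulVec u t := by
  obtain ⟨u, -, hu⟩ := finrank_eq_one_iff'.1 h
  have : ∀ j, ∃ c : K, ∀ i, G i j = u.1 i * c := fun j => by
    obtain ⟨c, hc⟩ := hu ⟨fun i => G i j, Submodule.subset_span ⟨j, rfl⟩⟩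
    refine ⟨c.unop, fun i => ?_⟩
    have := congrFun (congrArg Subtype.val hc) i
    exact this.symm
  choose t ht using this
  exact ⟨u.1, t, by ext i j; exact ht j i⟩

theorem ne_zero_of_rightRank_eq_one {n : ℕ} {G : Matrix (Fin n) (Fin n) K}
    (h : rightRank G = 1) : ∃ j, (fun i => G i j) ≠ 0 := by
  by_contra! hG
  have : Submodule.span Kᵐᵒᵖ (Set.range fun j : Fin n => fun i : Fin n => G i j) = ⊥ := by
    rw [Submodule.span_eq_bot]
    rintro _ ⟨j, rfl⟩
    exact hG j
  rw [rightRank, this, finrank_bot] at h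
  exact zero_ne_one h

/-- A measurable selection: go through the columns and keep one that is nonzero. Each test is a
measurable condition, so finitely many case distinctions stay measurable. -/
theorem exists_measurable_nonzero_column [BorelSpace K] (n : ℕ) :
    ∃ p : Matrix (Fin n) (Fin n) K → Fin n → K, Measurable p ∧
      ∀ G : Matrix (Fin n) (Fin n) K, (∃ j, (fun i => G i j) ≠ 0) →
        p G ≠ 0 ∧ ∃ j, p G = fun i => G i j := by
  classical
  suffices h : ∀ s : Finset (Fin n), ∃ p : Matrix (Fin n) (Fin n) K → Fin n → K, Measurable p ∧
      ∀ G : Matrix (Fin n) (Fin n) K, (∃ j ∈ s, (fun i => G i j) ≠ 0) →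
        p G ≠ 0 ∧ ∃ j, p G = fun i => G i j by
    obtain ⟨p, hp, h⟩ := h Finset.univ
    exact ⟨p, hp, fun G ⟨j, hj⟩ => h G ⟨j, Finset.mem_univ j, hj⟩⟩
  intro s
  induction s using Finset.induction_on with
  | empty => exact ⟨0, measurable_const, by simp⟩
  | insert a s _ ih =>
    obtain ⟨p, hp, h⟩ := ih
    have hcol : Measurable fun (G : Matrix (Fin n) (Fin n) K) (i : Fin n) => G i a :=
      measurable_pi_lambda _ fun i => measurable_id.matrix_apply i a
    refine ⟨fun G => if (fun i => G i a) = 0 then p G else fun i => G i a,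
      Measurable.ite (hcol (measurableSet_singleton 0)) hp hcol, fun G hG => ?_⟩
    by_cases ha : (fun i => G i a) = 0
    · simp only [ha, if_true]
      refine h G ?_
      obtain ⟨j, hj, hj'⟩ := hG
      rcases Finset.mem_insert.1 hj with rfl | hj
      · exact absurd ha hj'
      · exact ⟨j, hj, hj'⟩
    · simp only [ha, if_false]
      exact ⟨ha, a, rfl⟩

/-- A measurable choice of a unitary matrix which diagonalizes positive matrices of rank one. -/
theorem exists_measurable_unitary_diagonalizing [BorelSpace K] [SecondCountableTopology K]
    (k : ℕ) :
    ∃ U : Matrix (Fin (k + 1)) (Fin (k + 1)) K → Matrix (Fin (k + 1)) (Fin (k + 1)) K,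
      Measurable U ∧ (∀ G, U G ∈ unitary (Matrix (Fin (k + 1)) (Fin (k + 1)) K)) ∧
      ∀ G, IsPositive G → rightRank G = 1 →
        U G * G * (U G)ᴴ = Matrix.single 0 0 (algebraMap ℝ K (hsNorm G)) := by
  obtain ⟨p, hp, hpG⟩ := exists_measurable_nonzero_column (K := K) (k + 1)
  refine ⟨fun G => householder (p G), measurable_householder.comp hp,
    fun G => householder_mem_unitary _, fun G hG hr => ?_⟩
  obtain ⟨hne, j, hj⟩ := hpG G (ne_zero_of_rightRank_eq_one hr)
  -- The chosen column is `u t_j` with `t_j ≠ 0`, so its Householder matrix also sends `u` to a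
  -- right multiple of the first basis vector. After conjugation only the first row can be nonzero,
  -- and `eq_single_of_isPositive` applies.
  obtain ⟨u, t, rfl⟩ := exists_vecMulVec_of_rightRank_eq_one hr
  have htj : t j ≠ 0 := fun h0 => hne (by rw [hj]; funext i; simp [Matrix.vecMulVec_apply, h0])
  set G := Matrix.vecMulVec u t with hGdef
  have hQu : householder (p G) *ᵥ u =
      Pi.single 0 (algebraMap ℝ K (vecNorm (p G)) * (t j)⁻¹) := by
    have hu : u = fun i => p G i * (t j)⁻¹ := by
      funext i
      rw [hj]
      simp [hGdef, Matrix.vecMulVec_apply, htj]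
    have hs : householder (p G) *ᵥ u =
        fun i => (householder (p G) *ᵥ p G) i * (t j)⁻¹ := by
      conv_lhs => rw [hu]
      funext i
      simp [Matrix.mulVec, dotProduct, Finset.sum_mul, mul_assoc]
    rw [hs, householder_mulVec]
    funext i
    by_cases hi : i = 0
    · subst hi; simp
    · simp [hi]
  have key := eq_single_of_isPositive (hG.conj (householder (p G))) (fun i hi j => by
    have : householder (p G) * G = Matrix.vecMulVec (householder (p G) *ᵥ u) t := by
      rw [hGdef, Matrix.mul_vecMulVec]
    rw [this, hQu, Matrix.vecMulVec_mul, Matrix.vecMulVec_apply]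
    simp [hi])
  rwa [hsNorm_unitary_conj (householder_mem_unitary _)] at key

end Tridiagonalization

section GaussianVectors

variable {K : Type*} [NormedDivisionRing K] [NormedAlgebra ℝ K] [StarRing K]
  [StarModule ℝ K] [NormedStarGroup K] [MeasurableSpace K] [GaussianScalars K]
  [BorelSpace K] [SecondCountableTopology K]

/-! ### Gaussian vectors and matrices -/

/-- The law of a vector with independent standard Gaussian entries. -/
def gaussVector (K : Type*) [NormedDivisionRing K] [NormedAlgebra ℝ K] [StarRing K]
    [MeasurableSpace K] [GaussianScalars K] (n : ℕ) : Measure (Fin n → K) :=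
  Measure.pi fun _ => gauss

/-- The law of a matrix with independent standard Gaussian entries. -/
def gaussMatrix (K : Type*) [NormedDivisionRing K] [NormedAlgebra ℝ K] [StarRing K]
    [MeasurableSpace K] [GaussianScalars K] (m n : ℕ) : Measure (Matrix (Fin m) (Fin n) K) :=
  iidMatrix gauss m n

/-- The sum of the squared norms of the entries. -/
def frobSq {m n : ℕ} (A : Matrix (Fin m) (Fin n) K) : ℝ := ∑ i, ∑ j, ‖A i j‖ ^ 2

theorem isStdGaussian_gaussVector (n : ℕ) :
    IsStdGaussian (Fin n × Fin (dim K)) (fun v : Fin n → K => ∑ i, ‖v i‖ ^ 2) (gaussVector K n) :=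
  isStdGaussian_gauss.pi n

theorem isStdGaussian_gaussMatrix (m n : ℕ) :
    IsStdGaussian (Fin m × (Fin n × Fin (dim K))) (frobSq (K := K)) (gaussMatrix K m n) :=
  ((isStdGaussian_gaussVector (K := K) n).pi m).of_map (F := Matrix (Fin m) (Fin n) K)
    (M := frobSq) (Matrix.ofLinearEquiv ℝ)
    (measurable_matrix_of fun i j => (measurable_pi_apply j).comp (measurable_pi_apply i))
    fun _ => rfl

instance isProbabilityMeasure_gauss : IsProbabilityMeasure (gauss : Measure K) :=
  isStdGaussian_gauss.isProbabilityMeasure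

instance isProbabilityMeasure_gaussVector (n : ℕ) : IsProbabilityMeasure (gaussVector K n) :=
  (isStdGaussian_gaussVector n).isProbabilityMeasure

instance isProbabilityMeasure_gaussMatrix (m n : ℕ) : IsProbabilityMeasure (gaussMatrix K m n) :=
  (isStdGaussian_gaussMatrix m n).isProbabilityMeasure

theorem frobSq_conjTranspose {m n : ℕ} (A : Matrix (Fin m) (Fin n) K) : frobSq Aᴴ = frobSq A := by
  unfold frobSq
  rw [Finset.sum_comm]
  simp

theorem frobSq_unitary_mul {m n : ℕ} {U : Matrix (Fin m) (Fin m) K}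
    (hU : U ∈ unitary (Matrix (Fin m) (Fin m) K)) (A : Matrix (Fin m) (Fin n) K) :
    frobSq (U * A) = frobSq A := by
  unfold frobSq
  rw [Finset.sum_comm, Finset.sum_comm (f := fun j k => ‖A j k‖ ^ 2)]
  refine Finset.sum_congr rfl fun j _ => ?_
  have h := congrArg (· ^ 2) (vecNorm_mulVec_of_mem_unitary hU fun i => A i j)
  simp only [vecNorm_sq] at h
  exact h

theorem frobSq_mul_conjTranspose {m n : ℕ} {U : Matrix (Fin n) (Fin n) K}
    (hU : U ∈ unitary (Matrix (Fin n) (Fin n) K)) (A : Matrix (Fin m) (Fin n) K) :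
    frobSq (A * Uᴴ) = frobSq A := by
  rw [← frobSq_conjTranspose, Matrix.conjTranspose_mul, Matrix.conjTranspose_conjTranspose,
    frobSq_unitary_mul hU, frobSq_conjTranspose]

/-- Left multiplication by a unitary is real linear and an isometry on each column, so rotation
invariance of the Gaussian measure applies. -/
theorem measurePreserving_unitary_mul {m : ℕ} (n : ℕ) {U : Matrix (Fin m) (Fin m) K}
    (hU : U ∈ unitary (Matrix (Fin m) (Fin m) K)) :
    MeasurePreserving (fun Y => U * Y) (gaussMatrix K m n) (gaussMatrix K m n) :=
  (isStdGaussian_gaussMatrix m n).measurePreserving (isStdGaussian_gaussMatrix m n)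
    (fun _ _ => Matrix.mul_add _ _ _) (fun c Y => Matrix.mul_smul U c Y)
    (measurable_const.matrix_mul measurable_id) (frobSq_unitary_mul hU) rfl

theorem measurePreserving_mul_conjTranspose (m : ℕ) {n : ℕ} {U : Matrix (Fin n) (Fin n) K}
    (hU : U ∈ unitary (Matrix (Fin n) (Fin n) K)) :
    MeasurePreserving (fun Y => Y * Uᴴ) (gaussMatrix K m n) (gaussMatrix K m n) :=
  (isStdGaussian_gaussMatrix m n).measurePreserving (isStdGaussian_gaussMatrix m n)
    (fun _ _ => Matrix.add_mul _ _ _) (fun c Y => Matrix.smul_mul c Y Uᴴ)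
    (measurable_id.matrix_mul measurable_const) (frobSq_mul_conjTranspose hU) rfl

/-- The matrix with first column `c` and remaining columns `M`. -/
def consCol {m n : ℕ} (c : Fin m → K) (M : Matrix (Fin m) (Fin n) K) :
    Matrix (Fin m) (Fin (n + 1)) K := Matrix.of fun i => Fin.cons (c i) (M i)

/-- The matrix with first row `r` and remaining rows `M`. -/
def consRow {m n : ℕ} (r : Fin n → K) (M : Matrix (Fin m) (Fin n) K) :
    Matrix (Fin (m + 1)) (Fin n) K := Matrix.of (Fin.cons r M)

theorem measurable_consCol {m n : ℕ} :
    Measurable fun p : (Fin m → K) × Matrix (Fin m) (Fin n) K => consCol p.1 p.2 := by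
  refine measurable_matrix_of fun i j => ?_
  refine Fin.cases ?_ (fun j => ?_) j
  · exact (measurable_pi_apply i).comp measurable_fst
  · exact measurable_snd.matrix_apply i j

theorem measurable_consRow {m n : ℕ} :
    Measurable fun p : (Fin n → K) × Matrix (Fin m) (Fin n) K => consRow p.1 p.2 := by
  refine measurable_matrix_of fun i j => ?_
  refine Fin.cases ?_ (fun i => ?_) i
  · exact (measurable_pi_apply j).comp measurable_fst
  · exact measurable_snd.matrix_apply i j

/-- Splitting off a column only regroups the real coordinates. Regarded as an isometry, it yields
the independence of the column from the rest. -/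
theorem measurePreserving_consCol (m n : ℕ) :
    MeasurePreserving (fun p : (Fin m → K) × Matrix (Fin m) (Fin n) K => consCol p.1 p.2)
      ((gaussVector K m).prod (gaussMatrix K m n)) (gaussMatrix K m (n + 1)) := by
  refine ((isStdGaussian_gaussVector m).prod (isStdGaussian_gaussMatrix m n)).measurePreserving
    (isStdGaussian_gaussMatrix m (n + 1)) (fun x y => ?_) (fun c x => ?_) measurable_consCol
    (fun x => ?_) ?_
  · ext i j
    refine Fin.cases ?_ (fun j => ?_) j <;> rfl
  · ext i j
    refine Fin.cases ?_ (fun j => ?_) j <;> rfl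
  · simp [consCol, frobSq, Fin.sum_univ_succ, Finset.sum_add_distrib]
  · simp; ring

theorem measurePreserving_consRow (m n : ℕ) :
    MeasurePreserving (fun p : (Fin n → K) × Matrix (Fin m) (Fin n) K => consRow p.1 p.2)
      ((gaussVector K n).prod (gaussMatrix K m n)) (gaussMatrix K (m + 1) n) := by
  refine ((isStdGaussian_gaussVector n).prod (isStdGaussian_gaussMatrix m n)).measurePreserving
    (isStdGaussian_gaussMatrix (m + 1) n) (fun x y => ?_) (fun c x => ?_) measurable_consRow
    (fun x => ?_) ?_
  · ext i j
    refine Fin.cases ?_ (fun i => ?_) i <;> rfl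
  · ext i j
    refine Fin.cases ?_ (fun i => ?_) i <;> rfl
  · rw [frobSq, Fin.sum_univ_succ]
    rfl
  · simp; ring

theorem measurePreserving_border (n : ℕ) :
    MeasurePreserving (fun p : K × ((Fin n → K) × (Fin n → K)) × Matrix (Fin n) (Fin n) K =>
        border p.1 p.2.1.1 p.2.1.2 p.2.2)
      ((gauss : Measure K).prod (((gaussVector K n).prod (gaussVector K n)).prod
        (gaussMatrix K n n))) (gaussMatrix K (n + 1) (n + 1)) := by
  refine (isStdGaussian_gauss.prod (((isStdGaussian_gaussVector n).prod
    (isStdGaussian_gaussVector n)).prod (isStdGaussian_gaussMatrix n n))).measurePreserving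
    (isStdGaussian_gaussMatrix (n + 1) (n + 1)) (fun x y => ?_) (fun c x => ?_) ?_
    (fun x => ?_) ?_
  · exact (border_add _ _ _ _ _ _ _ _).symm
  · exact (border_smul _ _ _ _ _).symm
  · exact Measurable.border measurable_fst (measurable_fst.comp (measurable_fst.comp measurable_snd))
      (measurable_snd.comp (measurable_fst.comp measurable_snd))
      (measurable_snd.comp measurable_snd)
  · simp [frobSq, Fin.sum_univ_succ, Finset.sum_add_distrib]
    ring
  · simp; ring

theorem measurePreserving_vecNorm {n : ℕ} (hn : 0 < n) :
    MeasurePreserving vecNorm (gaussVector K n) (chi (dim K * n)) := by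
  refine ⟨measurable_vecNorm, ?_⟩
  have : Nonempty (Fin n × Fin (dim K)) := ⟨⟨⟨0, hn⟩, ⟨0, dim_pos⟩⟩⟩
  have h := (isStdGaussian_gaussVector (K := K) n).map_sqrt (by fun_prop)
  rw [Fintype.card_prod, Fintype.card_fin, Fintype.card_fin] at h
  rw [mul_comm (dim K : ℝ), ← Nat.cast_mul, ← h]
  rfl

/-! ### Half sums of Gaussian vectors -/

/-- The parallelogram law follows from `star x * x = ‖x‖²` alone; it makes the rotation by 45
degrees below an isometry. -/
theorem norm_add_sq_add_norm_sub_sq (a b : K) :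
    ‖a + b‖ ^ 2 + ‖a - b‖ ^ 2 = 2 * (‖a‖ ^ 2 + ‖b‖ ^ 2) := by
  apply (algebraMap ℝ K).injective
  rw [map_mul, map_add, map_add, ← star_mul_self_eq, ← star_mul_self_eq, ← star_mul_self_eq,
    ← star_mul_self_eq, map_ofNat, star_add, star_sub]
  noncomm_ring

/-- This is the first component of the isometry `(a, b) ↦ ((a + b*)/√2, (a - b*)/√2)` of the space
of pairs. -/
theorem measurePreserving_sqrt_two_inv_smul_add_star (n : ℕ) :
    MeasurePreserving (fun p : (Fin n → K) × (Fin n → K) => (√2)⁻¹ • (p.1 + star p.2))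
      ((gaussVector K n).prod (gaussVector K n)) (gaussVector K n) := by
  have hs : Measurable (star : K → K) := measurable_star_scalar
  have hs' : Measurable (star : (Fin n → K) → (Fin n → K)) :=
    measurable_pi_lambda _ fun i => hs.comp (measurable_pi_apply i)
  have h := ((isStdGaussian_gaussVector (K := K) n).prod
    (isStdGaussian_gaussVector n)).measurePreserving
    ((isStdGaussian_gaussVector n).prod (isStdGaussian_gaussVector n))
    (L := fun p => ((√2)⁻¹ • (p.1 + star p.2), (√2)⁻¹ • (p.1 - star p.2)))
    (fun x y => by
      ext i <;> simp only [Prod.fst_add, Prod.snd_add, star_add, Pi.smul_apply, Pi.add_apply,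
        Pi.sub_apply] <;> module)
    (fun c x => by
      ext i <;> simp only [Prod.smul_fst, Prod.smul_snd, star_smul, star_trivial, Pi.smul_apply,
        Pi.add_apply, Pi.sub_apply, Pi.star_apply] <;> module)
    (by
      refine Measurable.prodMk ?_ ?_
      · exact (measurable_fst.add (hs'.comp measurable_snd)).const_smul (√2)⁻¹
      · exact (measurable_fst.sub (hs'.comp measurable_snd)).const_smul (√2)⁻¹)
    (fun x => by
      rw [← Finset.sum_add_distrib, ← Finset.sum_add_distrib]
      refine Finset.sum_congr rfl fun i _ => ?_
      have h2 : ((√2)⁻¹ : ℝ) ^ 2 = 1 / 2 := by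
        rw [inv_pow, Real.sq_sqrt (by norm_num)]; norm_num
      have := norm_add_sq_add_norm_sub_sq (x.1 i) (star (x.2 i))
      rw [norm_star] at this
      simp only [Pi.smul_apply, Pi.add_apply, Pi.sub_apply, Pi.star_apply, norm_smul, mul_pow,
        Real.norm_eq_abs, sq_abs, h2]
      linarith)
    rfl
  exact measurePreserving_fst.comp h

/-- The average of a vector and the conjugate of another vector. -/
def halfSum {n : ℕ} (p : (Fin n → K) × (Fin n → K)) : Fin n → K :=
  (1 / 2 : ℝ) • (p.1 + star p.2)

theorem measurable_halfSum {n : ℕ} :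
    Measurable (halfSum : (Fin n → K) × (Fin n → K) → Fin n → K) := by
  have hs : Measurable (star : K → K) := measurable_star_scalar
  have hs' : Measurable (star : (Fin n → K) → (Fin n → K)) :=
    measurable_pi_lambda _ fun i => hs.comp (measurable_pi_apply i)
  exact (measurable_fst.add (hs'.comp measurable_snd)).const_smul (1 / 2 : ℝ)

theorem vecNorm_smul {n : ℕ} (c : ℝ) (v : Fin n → K) : vecNorm (c • v) = |c| * vecNorm v := by
  unfold vecNorm
  simp only [Pi.smul_apply, norm_smul, mul_pow, ← Finset.mul_sum]
  rw [Real.sqrt_mul (by positivity), Real.sqrt_sq (norm_nonneg _), Real.norm_eq_abs]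

/-- Write `1/2 = (1/√2)(1/√2)`: one factor makes the sum `a + b*` a standard Gaussian vector, whose
norm is `chi`; the other rescales `chi` to `chiTilde`. -/
theorem measurePreserving_vecNorm_halfSum {n : ℕ} (hn : 0 < n) :
    MeasurePreserving (fun p => vecNorm (halfSum p)) ((gaussVector K n).prod (gaussVector K n))
      (chiTilde (dim K * n)) := by
  have hd : (0 : ℝ) < dim K * n := by
    have : 0 < dim K := dim_pos
    positivity
  have h := ((measurePreserving_vecNorm hn).comp
    (measurePreserving_sqrt_two_inv_smul_add_star (K := K) n))
  have h2 : MeasurePreserving (fun x : ℝ => (√2)⁻¹ * x) (chi (dim K * n)) (chiTilde (dim K * n)) :=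
    ⟨by fun_prop, map_inv_sqrt_two_mul_chi hd⟩
  convert h2.comp h using 1
  funext p
  simp only [Function.comp_apply, halfSum, vecNorm_smul, ← mul_assoc]
  congr 1
  rw [abs_of_pos (by positivity), abs_of_pos (by positivity), ← mul_inv,
    Real.mul_self_sqrt (by norm_num)]
  norm_num

/-! ### The Hermitian ensemble -/

/-- The Hermitian ensemble over `K`. -/
def gaussHermitian (K : Type*) [NormedDivisionRing K] [NormedAlgebra ℝ K] [StarRing K]
    [MeasurableSpace K] [GaussianScalars K] (n : ℕ) : Measure (Matrix (Fin n) (Fin n) K) :=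
  hermitianEnsemble gauss n

/-- The Hermitian part of a matrix. -/
def hermitianPart {n : ℕ} (Y : Matrix (Fin n) (Fin n) K) : Matrix (Fin n) (Fin n) K :=
  (1 / 2 : ℝ) • (Y + Yᴴ)

theorem measurable_hermitianPart {n : ℕ} :
    Measurable (hermitianPart : Matrix (Fin n) (Fin n) K → _) := by
  refine measurable_matrix_of fun i j => ?_
  have hs : Measurable (star : K → K) := measurable_star_scalar
  simp only [hermitianPart, Matrix.smul_apply, Matrix.add_apply, Matrix.conjTranspose_apply]
  exact ((measurable_id.matrix_apply i j).add
    (hs.comp (measurable_id.matrix_apply j i))).const_smul (1 / 2 : ℝ)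

theorem measurePreserving_hermitianPart (n : ℕ) :
    MeasurePreserving hermitianPart (gaussMatrix K n n) (gaussHermitian K n) :=
  ⟨measurable_hermitianPart, rfl⟩

instance isProbabilityMeasure_gaussHermitian (n : ℕ) :
    IsProbabilityMeasure (gaussHermitian K n) :=
  Measure.isProbabilityMeasure_map (μ := gaussMatrix K n n) measurable_hermitianPart.aemeasurable

theorem isHermitian_hermitianPart {n : ℕ} (Y : Matrix (Fin n) (Fin n) K) :
    (hermitianPart Y).IsHermitian := by
  rw [Matrix.IsHermitian, hermitianPart, Matrix.conjTranspose_smul, Matrix.conjTranspose_add,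
    Matrix.conjTranspose_conjTranspose, star_trivial, add_comm]

theorem hermitianPart_conj {n : ℕ} (U Y : Matrix (Fin n) (Fin n) K) :
    hermitianPart (U * Y * Uᴴ) = U * hermitianPart Y * Uᴴ := by
  simp only [hermitianPart, Matrix.conjTranspose_mul, Matrix.conjTranspose_conjTranspose,
    Matrix.mul_smul, Matrix.smul_mul, Matrix.mul_add, Matrix.add_mul, Matrix.mul_assoc]

theorem measurePreserving_conj_gaussHermitian {n : ℕ} {U : Matrix (Fin n) (Fin n) K}
    (hU : U ∈ unitary (Matrix (Fin n) (Fin n) K)) :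
    MeasurePreserving (fun H => U * H * Uᴴ) (gaussHermitian K n) (gaussHermitian K n) := by
  have h1 := (measurePreserving_hermitianPart (K := K) n).comp
    ((measurePreserving_mul_conjTranspose n hU).comp (measurePreserving_unitary_mul n hU))
  refine ⟨measurable_conj measurable_const measurable_id, ?_⟩
  have hm : Measurable fun H : Matrix (Fin n) (Fin n) K => U * H * Uᴴ :=
    measurable_conj measurable_const measurable_id
  conv_lhs => rw [← (measurePreserving_hermitianPart n).map_eq]
  rw [Measure.map_map hm measurable_hermitianPart, ← h1.map_eq]
  congr 1
  funext Y
  exact (hermitianPart_conj U Y).symm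

theorem hermitianPart_border {n : ℕ} (y : K) (r c : Fin n → K) (Y : Matrix (Fin n) (Fin n) K) :
    hermitianPart (border y r c Y) = border (algebraMap ℝ K (re y)) (star (halfSum (c, r)))
      (halfSum (c, r)) (hermitianPart Y) := by
  rw [hermitianPart, conjTranspose_border, border_add, border_smul]
  congr 1
  · have h : star ((1 / 2 : ℝ) • (y + star y)) = (1 / 2 : ℝ) • (y + star y) := by
      rw [star_smul, star_add, star_star, star_trivial, add_comm]
    rw [eq_algebraMap_re _ h, map_smul, map_add, re_star, smul_eq_mul]
    congr 1
    ring
  · rw [halfSum, star_smul, star_add, star_star, star_trivial (1 / 2 : ℝ), add_comm]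

/-- The block decomposition of the Hermitian ensemble. -/
theorem measurePreserving_border_gaussHermitian (n : ℕ) :
    MeasurePreserving (fun p : ℝ × ((Fin n → K) × (Fin n → K)) × Matrix (Fin n) (Fin n) K =>
        border (algebraMap ℝ K p.1) (star (halfSum p.2.1)) (halfSum p.2.1) p.2.2)
      ((gaussianReal 0 1).prod (((gaussVector K n).prod (gaussVector K n)).prod
        (gaussHermitian K n))) (gaussHermitian K (n + 1)) := by
  have hm : Measurable fun p : ℝ × ((Fin n → K) × (Fin n → K)) × Matrix (Fin n) (Fin n) K =>
      border (algebraMap ℝ K p.1) (star (halfSum p.2.1)) (halfSum p.2.1) p.2.2 := by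
    have hs : Measurable (star : K → K) := measurable_star_scalar
    have hs' : Measurable (star : (Fin n → K) → (Fin n → K)) :=
      measurable_pi_lambda _ fun i => hs.comp (measurable_pi_apply i)
    have hh := (measurable_halfSum (K := K) (n := n)).comp
      ((measurable_fst.comp measurable_snd : Measurable fun p : ℝ × ((Fin n → K) × (Fin n → K)) ×
        Matrix (Fin n) (Fin n) K => p.2.1))
    exact Measurable.border (measurable_algebraMap_real.comp measurable_fst) (hs'.comp hh) hh
      (measurable_snd.comp measurable_snd)
  refine ⟨hm, ?_⟩
  have hre : MeasurePreserving (re : K → ℝ) gauss (gaussianReal 0 1) :=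
    ⟨measurable_re, map_re_gauss⟩
  -- The swap is needed because `border` lists the row before the column, while the half sum in
  -- `hermitianPart_border` takes the column first.
  have h1 := hre.prod ((Measure.measurePreserving_swap (μ := gaussVector K n)
    (ν := gaussVector K n)).prod (measurePreserving_hermitianPart (K := K) n))
  rw [← h1.map_eq, Measure.map_map hm h1.measurable,
    ← ((measurePreserving_hermitianPart (K := K) (n + 1)).comp (measurePreserving_border n)).map_eq]
  congr 1
  funext p
  exact (hermitianPart_border _ _ _ _).symm

end GaussianVectors

/-! ### Recursion for the tridiagonal ensembles -/

theorem measurePreserving_prodInterchange {α₁ α₂ α₃ α₄ : Type*} [MeasurableSpace α₁]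
    [MeasurableSpace α₂] [MeasurableSpace α₃] [MeasurableSpace α₄] (μ₁ : Measure α₁)
    (μ₂ : Measure α₂) (μ₃ : Measure α₃) (μ₄ : Measure α₄) [SFinite μ₁] [SFinite μ₂] [SFinite μ₃]
    [SFinite μ₄] :
    MeasurePreserving (fun p : α₁ × α₂ × α₃ × α₄ => ((p.1, p.2.2.1), (p.2.1, p.2.2.2)))
      (μ₁.prod (μ₂.prod (μ₃.prod μ₄))) ((μ₁.prod μ₃).prod (μ₂.prod μ₄)) := by
  have h1 := (MeasurePreserving.id μ₁).prod
    ((measurePreserving_prodAssoc μ₂ μ₃ μ₄).symm MeasurableEquiv.prodAssoc)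
  have h2 := (MeasurePreserving.id μ₁).prod
    ((Measure.measurePreserving_swap (μ := μ₂) (ν := μ₃)).prod (MeasurePreserving.id μ₄))
  have h3 := (MeasurePreserving.id μ₁).prod (measurePreserving_prodAssoc μ₃ μ₂ μ₄)
  have h4 := (measurePreserving_prodAssoc μ₁ μ₃ (μ₂.prod μ₄)).symm MeasurableEquiv.prodAssoc
  exact h4.comp (h3.comp (h2.comp h1))

theorem measurePreserving_finCons {k : ℕ} (μ : Fin (k + 1) → Measure ℝ)
    [∀ i, SigmaFinite (μ i)] :
    MeasurePreserving (fun p : ℝ × (Fin k → ℝ) => (Fin.cons p.1 p.2 : Fin (k + 1) → ℝ))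
      ((μ 0).prod (Measure.pi fun i => μ i.succ)) (Measure.pi μ) := by
  have h := (measurePreserving_piFinSuccAbove μ 0).symm
    (MeasurableEquiv.piFinSuccAbove (fun _ => ℝ) 0)
  simp only [Fin.zero_succAbove] at h
  convert h using 1
  funext p
  simp [MeasurableEquiv.piFinSuccAbove]
  rfl

theorem measurePreserving_finCons_prod {k l : ℕ} (μ : Fin (k + 1) → Measure ℝ)
    (ν : Fin (l + 1) → Measure ℝ) [∀ i, SigmaFinite (μ i)] [∀ i, SigmaFinite (ν i)] :
    MeasurePreserving (fun p : ℝ × ℝ × (Fin k → ℝ) × (Fin l → ℝ) =>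
        ((Fin.cons p.1 p.2.2.1 : Fin (k + 1) → ℝ), (Fin.cons p.2.1 p.2.2.2 : Fin (l + 1) → ℝ)))
      ((μ 0).prod ((ν 0).prod ((Measure.pi fun i => μ i.succ).prod
        (Measure.pi fun i => ν i.succ)))) ((Measure.pi μ).prod (Measure.pi ν)) :=
  ((measurePreserving_finCons μ).prod (measurePreserving_finCons ν)).comp
    (measurePreserving_prodInterchange _ _ _ _)

theorem jacobi_cons {k : ℕ} (a₀ b₀ : ℝ) (a : Fin k → ℝ) (b : Fin (k + 1) → ℝ) :
    jacobi (n := k + 2) (Fin.cons a₀ a : Fin (k + 1) → ℝ) (Fin.cons b₀ b) =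
      border b₀ (Pi.single 0 a₀) (Pi.single 0 a₀) (jacobi (n := k + 1) a b) := by
  refine ext_border ?_ (fun j => ?_) (fun i => ?_) fun i j => ?_
  · simp [jacobi]
  · rw [border_zero_succ]
    by_cases hj : j = 0
    · subst hj; simp [jacobi]
    · simp [jacobi, hj, (Fin.succ_ne_zero j).symm]
  · rw [border_succ_zero]
    by_cases hi : i = 0
    · subst hi; simp [jacobi]
    · simp [jacobi, hi]
  · simp only [jacobi, Matrix.of_apply, border_succ_succ, Fin.succ_inj, Fin.cons_succ,
      Fin.val_succ, add_left_inj]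
    rfl

theorem bidiagonal_cons {k : ℕ} (x₀ y₀ : ℝ) (x : Fin (k + 1) → ℝ) (y : Fin k → ℝ) :
    bidiagonal (n := k + 2) (Fin.cons x₀ x) (Fin.cons y₀ y : Fin (k + 1) → ℝ) =
      border x₀ (Pi.single 0 y₀) 0 (bidiagonal (n := k + 1) x y) := by
  refine ext_border ?_ (fun j => ?_) (fun i => ?_) fun i j => ?_
  · simp [bidiagonal]
  · rw [border_zero_succ]
    by_cases hj : j = 0
    · subst hj; simp [bidiagonal]
    · simp [bidiagonal, hj, (Fin.succ_ne_zero j).symm]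
  · simp [bidiagonal]
  · simp only [bidiagonal, Matrix.of_apply, border_succ_succ, Fin.succ_inj, Fin.cons_succ,
      Fin.val_succ, add_left_inj]
    rfl

/-- One step of the recursion for Gaussian ensembles. -/
def gaussianStep {k : ℕ} (p : ℝ × ℝ × Matrix (Fin (k + 1)) (Fin (k + 1)) ℝ) :
    Matrix (Fin (k + 2)) (Fin (k + 2)) ℝ :=
  border p.1 (Pi.single 0 p.2.1) (Pi.single 0 p.2.1) p.2.2

/-- One step of the recursion for Wishart ensembles. -/
def wishartStep {k : ℕ} (p : ℝ × ℝ × Matrix (Fin (k + 1)) (Fin (k + 1)) ℝ) :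
    Matrix (Fin (k + 2)) (Fin (k + 2)) ℝ :=
  border (p.1 ^ 2) (Pi.single 0 (p.1 * p.2.1)) (Pi.single 0 (p.1 * p.2.1))
    (p.2.2 + Matrix.single 0 0 (p.2.1 ^ 2))

theorem measurable_gaussianStep {k : ℕ} : Measurable (gaussianStep (k := k)) := by
  have h : Measurable fun p : ℝ × ℝ × Matrix (Fin (k + 1)) (Fin (k + 1)) ℝ =>
      (Pi.single 0 p.2.1 : Fin (k + 1) → ℝ) :=
    measurable_pi_single_zero.comp (measurable_fst.comp measurable_snd)
  exact Measurable.border measurable_fst h h (measurable_snd.comp measurable_snd)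

theorem measurable_wishartStep {k : ℕ} : Measurable (wishartStep (k := k)) := by
  have h : Measurable fun p : ℝ × ℝ × Matrix (Fin (k + 1)) (Fin (k + 1)) ℝ =>
      (Pi.single 0 (p.1 * p.2.1) : Fin (k + 1) → ℝ) :=
    measurable_pi_single_zero.comp (measurable_fst.mul (measurable_fst.comp measurable_snd))
  refine Measurable.border (measurable_fst.pow_const 2) h h
    ((measurable_snd.comp measurable_snd).matrix_add (measurable_matrix_of fun i j => ?_))
  simp only [Matrix.single_apply]
  split_ifs
  · exact (measurable_fst.comp measurable_snd).pow_const 2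
  · exact measurable_const

/-- Block multiplication of the bordered bidiagonal matrix by its transpose: the new row `(x, y, 0,
…)` contributes `x²`, `x y` and the corner term `y²` of the remaining block. -/
theorem wishartStep_eq {k : ℕ} (x y : ℝ) (B : Matrix (Fin (k + 1)) (Fin (k + 1)) ℝ) :
    wishartStep (x, y, Bᵀ * B) =
      (border x (Pi.single 0 y) 0 B)ᵀ * border x (Pi.single 0 y) 0 B := by
  have ht : (border x (Pi.single 0 y) 0 B)ᵀ = border x 0 (Pi.single 0 y) Bᵀ :=
    ext_border rfl (fun _ => rfl) (fun _ => rfl) fun _ _ => rfl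
  rw [ht, border_mul, wishartStep]
  congr 1
  · simp; ring
  · funext j
    by_cases hj : j = 0
    · subst hj; simp
    · simp [hj]
  · funext j
    by_cases hj : j = 0
    · subst hj; simp; ring
    · simp [hj]
  · refine (add_comm _ _).trans (congrArg (· + _) ?_)
    ext i j
    by_cases hi : i = 0
    · subst hi
      by_cases hj : j = 0
      · subst hj; simp [Matrix.vecMulVec_apply]; ring
      · simp [Matrix.vecMulVec_apply, hj, Ne.symm hj]
    · simp [Matrix.vecMulVec_apply, hi, Ne.symm hi]

theorem measurable_jacobi {n : ℕ} :
    Measurable fun p : (Fin n → ℝ) × (Fin (n - 1) → ℝ) => jacobi p.2 p.1 := by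
  refine measurable_matrix_of fun i j => ?_
  simp only [jacobi, Matrix.of_apply]
  split_ifs <;> fun_prop

theorem measurable_bidiagonal {n : ℕ} :
    Measurable fun p : (Fin n → ℝ) × (Fin (n - 1) → ℝ) => bidiagonal p.1 p.2 := by
  refine measurable_matrix_of fun i j => ?_
  simp only [bidiagonal, Matrix.of_apply]
  split_ifs <;> fun_prop

theorem measurable_bidiagonal_gram {n : ℕ} :
    Measurable fun p : (Fin n → ℝ) × (Fin (n - 1) → ℝ) =>
      (bidiagonal p.1 p.2)ᵀ * bidiagonal p.1 p.2 :=
  measurable_bidiagonal.matrix_transpose.matrix_mul measurable_bidiagonal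

section

variable {β : ℝ}

theorem isProbabilityMeasure_chiTilde_coeff (hβ : 0 < β) {n : ℕ} (i : Fin (n - 1)) :
    IsProbabilityMeasure (chiTilde (β * ((n : ℝ) - ((i.val : ℝ) + 1)))) := by
  refine isProbabilityMeasure_chiTilde (mul_pos hβ ?_)
  have : i.val + 1 < n := by omega
  have : (i.val : ℝ) + 1 < n := by exact_mod_cast this
  linarith

theorem isProbabilityMeasure_diag_coeff (hβ : 0 < β) (m : ℕ) (i : ℕ) :
    IsProbabilityMeasure
      (if i < m then chi (β * ((m : ℝ) - ((i : ℝ) + 1) + 1)) else Measure.dirac 0) := by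
  split_ifs with h
  · refine isProbabilityMeasure_chi (mul_pos hβ ?_)
    have : (i : ℝ) < m := by exact_mod_cast h
    linarith
  · infer_instance

theorem isProbabilityMeasure_superdiag_coeff (hβ : 0 < β) (m : ℕ) {n : ℕ} (i : Fin (n - 1)) :
    IsProbabilityMeasure
      (if i.val < m then chi (β * ((n : ℝ) - ((i.val : ℝ) + 1))) else Measure.dirac 0) := by
  split_ifs with h
  · refine isProbabilityMeasure_chi (mul_pos hβ ?_)
    have : i.val + 1 < n := by omega
    have : (i.val : ℝ) + 1 < n := by exact_mod_cast this
    linarith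
  · infer_instance

/-- With the diagonal factor first, as in the Laguerre model, both recursions can use
`measurePreserving_finCons_prod`. -/
theorem gaussianBetaEnsemble_eq (hβ : 0 < β) (n : ℕ) :
    gaussianBetaEnsemble β n = ((Measure.pi fun _ : Fin n => gaussianReal 0 1).prod
      (Measure.pi fun i : Fin (n - 1) => chiTilde (β * ((n : ℝ) - ((i.val : ℝ) + 1))))).map
        fun p => jacobi p.2 p.1 := by
  have := fun i : Fin (n - 1) => isProbabilityMeasure_chiTilde_coeff hβ i
  rw [gaussianBetaEnsemble, ← Measure.prod_swap, Measure.map_map _ measurable_swap]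
  · rfl
  · exact measurable_jacobi.comp measurable_swap

theorem isProbabilityMeasure_gaussianBetaEnsemble (hβ : 0 < β) (n : ℕ) :
    IsProbabilityMeasure (gaussianBetaEnsemble β n) := by
  have := fun i : Fin (n - 1) => isProbabilityMeasure_chiTilde_coeff hβ i
  rw [gaussianBetaEnsemble_eq hβ]
  exact Measure.isProbabilityMeasure_map measurable_jacobi.aemeasurable

theorem isProbabilityMeasure_laguerreBetaEnsemble (hβ : 0 < β) (m n : ℕ) :
    IsProbabilityMeasure (laguerreBetaEnsemble β m n) := by
  have := fun i : Fin n => isProbabilityMeasure_diag_coeff hβ m i.val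
  have := fun i : Fin (n - 1) => isProbabilityMeasure_superdiag_coeff hβ m i
  exact Measure.isProbabilityMeasure_map measurable_bidiagonal_gram.aemeasurable

/-- The parameter `β (n - j)` is unchanged when `n` and `j` both drop by one, so the coefficients
after the first are those of the model of size `n - 1`. -/
theorem gaussianBetaEnsemble_succ_succ (hβ : 0 < β) (k : ℕ) :
    gaussianBetaEnsemble β (k + 2) = ((gaussianReal 0 1).prod ((chiTilde (β * (k + 1 : ℕ))).prod
      (gaussianBetaEnsemble β (k + 1)))).map gaussianStep := by
  have i1 := fun i : Fin (k + 2 - 1) => isProbabilityMeasure_chiTilde_coeff hβ i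
  have i2 := fun i : Fin (k + 1 - 1) => isProbabilityMeasure_chiTilde_coeff hβ i
  have i3 := isProbabilityMeasure_gaussianBetaEnsemble hβ (k + 1)
  have i4 : IsProbabilityMeasure (chiTilde (β * (k + 1 : ℕ))) :=
    isProbabilityMeasure_chiTilde (by positivity)
  have hcons := measurePreserving_finCons_prod (k := k + 1) (l := k)
    (fun _ : Fin (k + 2) => gaussianReal 0 1)
    (fun i : Fin (k + 1) => chiTilde (β * (((k + 2 : ℕ) : ℝ) - ((i.val : ℝ) + 1))))
  have hJ : MeasurePreserving
      (fun p : (Fin (k + 1) → ℝ) × (Fin k → ℝ) => jacobi (n := k + 1) p.2 p.1)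
      ((Measure.pi fun _ : Fin (k + 1) => gaussianReal 0 1).prod
        (Measure.pi fun i : Fin k => chiTilde (β * (((k + 1 : ℕ) : ℝ) - ((i.val : ℝ) + 1)))))
      (gaussianBetaEnsemble β (k + 1)) :=
    ⟨measurable_jacobi, (gaussianBetaEnsemble_eq hβ (k + 1)).symm⟩
  have h0 : chiTilde (β * (((k + 2 : ℕ) : ℝ) - (((0 : Fin (k + 1)).val : ℝ) + 1))) =
      chiTilde (β * (k + 1 : ℕ)) := by
    congr 2; push_cast; simp; ring
  have hsucc : (fun i : Fin k => chiTilde (β * (((k + 2 : ℕ) : ℝ) - ((i.succ.val : ℝ) + 1)))) =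
      fun i : Fin k => chiTilde (β * (((k + 1 : ℕ) : ℝ) - ((i.val : ℝ) + 1))) := by
    funext i; congr 2; push_cast; simp; ring
  rw [h0, hsucc] at hcons
  have hstep := (MeasurePreserving.id (gaussianReal 0 1)).prod
    ((MeasurePreserving.id (chiTilde (β * (k + 1 : ℕ)))).prod hJ)
  rw [← hstep.map_eq, Measure.map_map measurable_gaussianStep hstep.measurable,
    gaussianBetaEnsemble_eq hβ (k + 2)]
  refine (congrArg (Measure.map _) hcons.map_eq.symm).trans ?_
  rw [Measure.map_map (measurable_jacobi (n := k + 2)) hcons.measurable]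
  congr 1
  funext p
  exact jacobi_cons _ _ _ _

/-- The parameters `β (m - j + 1)`, `β (n - j)` and the cutoff `j ≤ m` are all unchanged when `m`,
`n` and `j` drop by one together. Hence both dimensions decrease in the recursion, and the case `m <
n` needs no separate treatment. -/
theorem laguerreBetaEnsemble_succ_succ_succ (hβ : 0 < β) (m k : ℕ) :
    laguerreBetaEnsemble β (m + 1) (k + 2) = ((chi (β * (m + 1 : ℕ))).prod
      ((chi (β * (k + 1 : ℕ))).prod (laguerreBetaEnsemble β m (k + 1)))).map wishartStep := by
  have i1 := fun i : Fin (k + 2) => isProbabilityMeasure_diag_coeff hβ (m + 1) i.val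
  have i2 := fun i : Fin (k + 2 - 1) => isProbabilityMeasure_superdiag_coeff hβ (m + 1) i
  have i3 := fun i : Fin (k + 1) => isProbabilityMeasure_diag_coeff hβ m i.val
  have i4 := fun i : Fin (k + 1 - 1) => isProbabilityMeasure_superdiag_coeff hβ m i
  have i5 := isProbabilityMeasure_laguerreBetaEnsemble hβ m (k + 1)
  have i6 : IsProbabilityMeasure (chi (β * (k + 1 : ℕ))) :=
    isProbabilityMeasure_chi (by positivity)
  have i7 : IsProbabilityMeasure (chi (β * (m + 1 : ℕ))) :=
    isProbabilityMeasure_chi (by positivity)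
  have hcons := measurePreserving_finCons_prod (k := k + 1) (l := k)
    (fun i : Fin (k + 2) => if i.val < m + 1 then
      chi (β * (((m + 1 : ℕ) : ℝ) - ((i.val : ℝ) + 1) + 1)) else Measure.dirac 0)
    (fun i : Fin (k + 1) => if i.val < m + 1 then
      chi (β * (((k + 2 : ℕ) : ℝ) - ((i.val : ℝ) + 1))) else Measure.dirac 0)
  have hL : MeasurePreserving
      (fun p : (Fin (k + 1) → ℝ) × (Fin k → ℝ) =>
        (bidiagonal (n := k + 1) p.1 p.2)ᵀ * bidiagonal (n := k + 1) p.1 p.2)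
      ((Measure.pi fun i : Fin (k + 1) => if i.val < m then
          chi (β * ((m : ℝ) - ((i.val : ℝ) + 1) + 1)) else Measure.dirac 0).prod
        (Measure.pi fun i : Fin k => if i.val < m then
          chi (β * (((k + 1 : ℕ) : ℝ) - ((i.val : ℝ) + 1))) else Measure.dirac 0))
      (laguerreBetaEnsemble β m (k + 1)) :=
    ⟨measurable_bidiagonal_gram, rfl⟩
  have h0 : (if (0 : Fin (k + 2)).val < m + 1 then chi (β * (((m + 1 : ℕ) : ℝ) -
      (((0 : Fin (k + 2)).val : ℝ) + 1) + 1)) else Measure.dirac 0) = chi (β * (m + 1 : ℕ)) := by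
    rw [if_pos (by simp)]; congr 2; push_cast; simp
  have h0' : (if (0 : Fin (k + 1)).val < m + 1 then chi (β * (((k + 2 : ℕ) : ℝ) -
      (((0 : Fin (k + 1)).val : ℝ) + 1))) else Measure.dirac 0) = chi (β * (k + 1 : ℕ)) := by
    rw [if_pos (by simp)]; congr 2; push_cast; simp; ring
  have hsucc : (fun i : Fin (k + 1) => if i.succ.val < m + 1 then chi (β * (((m + 1 : ℕ) : ℝ) -
      ((i.succ.val : ℝ) + 1) + 1)) else Measure.dirac 0) = fun i : Fin (k + 1) => if i.val < m then
      chi (β * ((m : ℝ) - ((i.val : ℝ) + 1) + 1)) else Measure.dirac 0 := by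
    funext i
    simp only [Fin.val_succ, add_lt_add_iff_right]
    congr 3; push_cast; ring
  have hsucc' : (fun i : Fin k => if i.succ.val < m + 1 then chi (β * (((k + 2 : ℕ) : ℝ) -
      ((i.succ.val : ℝ) + 1))) else Measure.dirac 0) = fun i : Fin k => if i.val < m then
      chi (β * (((k + 1 : ℕ) : ℝ) - ((i.val : ℝ) + 1))) else Measure.dirac 0 := by
    funext i
    simp only [Fin.val_succ, add_lt_add_iff_right]
    congr 3; push_cast; ring
  rw [h0, h0', hsucc, hsucc'] at hcons
  have hstep := (MeasurePreserving.id (chi (β * (m + 1 : ℕ)))).prod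
    ((MeasurePreserving.id (chi (β * (k + 1 : ℕ)))).prod hL)
  rw [← hstep.map_eq, Measure.map_map measurable_wishartStep hstep.measurable]
  refine (congrArg (Measure.map _) hcons.map_eq.symm).trans ?_
  rw [Measure.map_map (measurable_bidiagonal_gram (n := k + 2)) hcons.measurable]
  congr 1
  funext p
  simp only [Function.comp_apply, Prod.map, id]
  rw [wishartStep_eq, bidiagonal_cons]

theorem gaussianBetaEnsemble_one (hβ : 0 < β) :
    gaussianBetaEnsemble β 1 = (gaussianReal 0 1).map fun t => Matrix.of fun _ _ => t := by
  have h1 : MeasurePreserving (fun t : ℝ => fun _ : Fin 1 => t) (gaussianReal 0 1)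
      (Measure.pi fun _ : Fin 1 => gaussianReal 0 1) :=
    (measurePreserving_piUnique fun _ : Fin 1 => gaussianReal 0 1).symm
      (MeasurableEquiv.piUnique fun _ : Fin 1 => ℝ)
  have : IsEmpty (Fin (1 - 1)) := inferInstanceAs (IsEmpty (Fin 0))
  have hd : Measure.pi (fun i : Fin (1 - 1) => chiTilde (β * (((1 : ℕ) : ℝ) - ((i.val : ℝ) + 1)))) =
      Measure.dirac isEmptyElim := Measure.pi_of_empty _
  rw [gaussianBetaEnsemble_eq hβ, hd, Measure.prod_dirac, ← h1.map_eq,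
    Measure.map_map (by fun_prop) h1.measurable, Measure.map_map measurable_jacobi
      (Measurable.comp (by fun_prop) h1.measurable)]
  congr 1
  funext t
  ext i j
  fin_cases i; fin_cases j
  simp [jacobi]

theorem laguerreBetaEnsemble_one (hβ : 0 < β) (m : ℕ) :
    laguerreBetaEnsemble β (m + 1) 1 =
      (chi (β * (m + 1 : ℕ))).map fun t => Matrix.of fun _ _ => t ^ 2 := by
  have i1 := fun i : Fin 1 => isProbabilityMeasure_diag_coeff hβ (m + 1) i.val
  have h1 := (measurePreserving_piUnique fun i : Fin 1 => if i.val < m + 1 then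
      chi (β * (((m + 1 : ℕ) : ℝ) - ((i.val : ℝ) + 1) + 1)) else Measure.dirac 0).symm
      (MeasurableEquiv.piUnique fun _ : Fin 1 => ℝ)
  have h0 : (if (default : Fin 1).val < m + 1 then chi (β * (((m + 1 : ℕ) : ℝ) -
      (((default : Fin 1).val : ℝ) + 1) + 1)) else Measure.dirac 0) = chi (β * (m + 1 : ℕ)) := by
    rw [if_pos (by simp)]; congr 2; push_cast; simp
  rw [h0] at h1
  have : IsEmpty (Fin (1 - 1)) := inferInstanceAs (IsEmpty (Fin 0))
  have hd : Measure.pi (fun i : Fin (1 - 1) => if i.val < m + 1 then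
      chi (β * (((1 : ℕ) : ℝ) - ((i.val : ℝ) + 1))) else Measure.dirac 0) =
      Measure.dirac isEmptyElim := Measure.pi_of_empty _
  rw [laguerreBetaEnsemble, hd, Measure.prod_dirac, ← h1.map_eq,
    Measure.map_map (by fun_prop) h1.measurable, Measure.map_map measurable_bidiagonal_gram
      (Measurable.comp (by fun_prop) h1.measurable)]
  congr 1
  funext t
  ext i j
  fin_cases i; fin_cases j
  simp [bidiagonal, Matrix.mul_apply, MeasurableEquiv.piUnique]
  ring

theorem pi_dirac {ι : Type*} [Fintype ι] (x : ι → ℝ) :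
    Measure.pi (fun i => Measure.dirac (x i)) = Measure.dirac x := by
  refine Measure.pi_eq fun s hs => ?_
  rw [Measure.dirac_apply' _ (MeasurableSet.univ_pi hs)]
  simp_rw [fun i => Measure.dirac_apply' (x i) (hs i)]
  by_cases h : x ∈ Set.univ.pi s
  · rw [Set.indicator_of_mem h, Finset.prod_eq_one]
    · rfl
    · intro i _
      rw [Set.indicator_of_mem (h i (Set.mem_univ i))]
      rfl
  · rw [Set.indicator_of_notMem h]
    simp only [Set.mem_univ_pi, not_forall] at h
    obtain ⟨i, hi⟩ := h
    rw [Finset.prod_eq_zero (Finset.mem_univ i) (Set.indicator_of_notMem hi _)]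

/-- The end of the recursion when `m < n`: the rows are used up, and all further coefficients are
Dirac masses at zero. -/
theorem laguerreBetaEnsemble_zero (n : ℕ) : laguerreBetaEnsemble β 0 n = Measure.dirac 0 := by
  simp only [laguerreBetaEnsemble, Nat.not_lt_zero, if_false]
  rw [pi_dirac, pi_dirac, Measure.dirac_prod_dirac, Measure.map_dirac' measurable_bidiagonal_gram]
  congr 1
  have : bidiagonal (fun _ : Fin n => (0 : ℝ)) (fun _ : Fin (n - 1) => 0) = 0 := by
    ext i j
    simp [bidiagonal]
  rw [this, Matrix.mul_zero]

end

section Laws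

variable {K : Type*} [NormedDivisionRing K] [NormedAlgebra ℝ K] [StarRing K]
  [StarModule ℝ K] [NormedStarGroup K] [MeasurableSpace K] [GaussianScalars K]
  [BorelSpace K] [SecondCountableTopology K]

/-! ### The law of the tridiagonal form -/

theorem dim_cast_pos : (0 : ℝ) < dim K := by
  have : 0 < dim K := dim_pos
  exact_mod_cast this

theorem tridiagonal_border {k : ℕ} (h : ℝ) (r v : Fin (k + 1) → K)
    (H : Matrix (Fin (k + 1)) (Fin (k + 1)) K) :
    tridiagonal (k + 1) (border (algebraMap ℝ K h) r v H) =
      gaussianStep (h, vecNorm v, tridiagonal k (householder v * H * (householder v)ᴴ)) := by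
  rw [tridiagonal, border_zero_zero, re_algebraMap]
  rfl

/-- For each fixed first column, conjugation by its Householder matrix preserves the law of the
block. So the corner, the norm of the column and the deflated block are independent, with the laws
required by `gaussianBetaEnsemble_succ_succ`. -/
theorem measurePreserving_tridiagonal_gaussHermitian (k : ℕ) :
    MeasurePreserving (tridiagonal k) (gaussHermitian K (k + 1))
      (gaussianBetaEnsemble (dim K) (k + 1)) := by
  refine ⟨measurable_tridiagonal k, ?_⟩
  induction k with
  | zero =>
    have hB := measurePreserving_border_gaussHermitian (K := K) 0
    rw [gaussianBetaEnsemble_one dim_cast_pos, ← hB.map_eq,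
      Measure.map_map (measurable_tridiagonal 0) hB.measurable]
    have hfst : MeasurePreserving Prod.fst ((gaussianReal 0 1).prod
        (((gaussVector K 0).prod (gaussVector K 0)).prod (gaussHermitian K 0)))
        (gaussianReal 0 1) := measurePreserving_fst
    have hm : Measurable fun t : ℝ => (Matrix.of fun _ _ => t : Matrix (Fin 1) (Fin 1) ℝ) :=
      measurable_matrix_of fun _ _ => measurable_id
    refine Eq.trans ?_ (congrArg (Measure.map _) hfst.map_eq)
    rw [Measure.map_map hm measurable_fst]
    congr 1
    funext p
    ext i j
    simp [tridiagonal, re_algebraMap]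
  | succ k ih =>
    have hB := measurePreserving_border_gaussHermitian (K := K) (k + 1)
    have ih' : MeasurePreserving (tridiagonal k) (gaussHermitian K (k + 1))
      (gaussianBetaEnsemble (dim K) (k + 1)) := ⟨measurable_tridiagonal k, ih⟩
    have hstep := (MeasurePreserving.id (gaussianReal 0 1)).prod
      ((measurePreserving_vecNorm_halfSum (K := K) k.succ_pos).skew_product
        (μc := gaussHermitian K (k + 1)) (μd := gaussianBetaEnsemble (dim K) (k + 1))
        (g := fun p H => tridiagonal k
          (householder (halfSum p) * H * (householder (halfSum p))ᴴ))
        ((measurable_tridiagonal k).comp (measurable_conj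
          (measurable_householder.comp (measurable_halfSum.comp measurable_fst)) measurable_snd))
        (ae_of_all _ fun p =>
          (ih'.comp (measurePreserving_conj_gaussHermitian (householder_mem_unitary _))).map_eq))
    rw [gaussianBetaEnsemble_succ_succ dim_cast_pos, ← hB.map_eq,
      Measure.map_map (measurable_tridiagonal (k + 1)) hB.measurable, ← hstep.map_eq,
      Measure.map_map measurable_gaussianStep hstep.measurable]
    congr 1
    funext p
    exact tridiagonal_border _ _ _ _

/-! ### Householder reduction of Gram matrices (the Wishart case) -/

theorem mul_consCol {m n : ℕ} (U : Matrix (Fin m) (Fin m) K) (c : Fin m → K)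
    (M : Matrix (Fin m) (Fin n) K) : U * consCol c M = consCol (U *ᵥ c) (U * M) := by
  ext i j
  refine Fin.cases ?_ (fun j => ?_) j <;> rfl

theorem consCol_single_consRow {m n : ℕ} (x : K) (r : Fin n → K) (Z : Matrix (Fin m) (Fin n) K) :
    consCol (Pi.single 0 x) (consRow r Z) = border x r 0 Z := by
  refine ext_border ?_ (fun j => ?_) (fun i => ?_) fun i j => ?_
  · simp [consCol]
  · rfl
  · simp [consCol]
  · rfl

theorem gram_unitary_mul {m n : ℕ} {U : Matrix (Fin m) (Fin m) K}
    (hU : U ∈ unitary (Matrix (Fin m) (Fin m) K)) (Y : Matrix (Fin m) (Fin n) K) :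
    (U * Y)ᴴ * (U * Y) = Yᴴ * Y := by
  have h := (Unitary.mem_iff.1 hU).1
  rw [Matrix.star_eq_conjTranspose] at h
  rw [Matrix.conjTranspose_mul, Matrix.mul_assoc, ← Matrix.mul_assoc Uᴴ, h, Matrix.one_mul]

theorem gram_mul_conjTranspose {m n : ℕ} (U : Matrix (Fin n) (Fin n) K)
    (Y : Matrix (Fin m) (Fin n) K) : (Y * Uᴴ)ᴴ * (Y * Uᴴ) = U * (Yᴴ * Y) * Uᴴ := by
  simp only [Matrix.conjTranspose_mul, Matrix.conjTranspose_conjTranspose, Matrix.mul_assoc]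

/-- Left multiplication by the Householder matrix of `c` does not change the Gram matrix; it turns
`c` into `‖c‖ e₁` and cancels the adjoint in front of the other columns, leaving the rows `r` and
`Z`. -/
theorem gram_consCol_householder {m k : ℕ} (c : Fin (m + 1) → K) (r : Fin k → K)
    (Z : Matrix (Fin m) (Fin k) K) :
    (consCol c ((householder c)ᴴ * consRow r Z))ᴴ * consCol c ((householder c)ᴴ * consRow r Z) =
      border (algebraMap ℝ K (vecNorm c ^ 2)) (vecNorm c • r) (vecNorm c • star r)
        (Matrix.vecMulVec (star r) r + Zᴴ * Z) := by
  have hU := householder_mem_unitary c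
  have h := (Unitary.mem_iff.1 hU).2
  rw [Matrix.star_eq_conjTranspose] at h
  rw [← gram_unitary_mul hU, mul_consCol, householder_mulVec, ← Matrix.mul_assoc, h,
    Matrix.one_mul, consCol_single_consRow, conjTranspose_border, border_mul]
  congr 1
  · simp [star_algebraMap_real, pow_two]
  · funext j
    simp [star_algebraMap_real, Algebra.smul_def]
  · funext i
    simp [Algebra.smul_def, Algebra.commutes]

/-- The first column of the Gram matrix is `‖c‖ r*`, but the reflection built from it must also
straighten `r*` itself. This requires a positive factor. -/
theorem householder_smul_mulVec {k : ℕ} {s : ℝ} (hs : 0 < s) (v : Fin (k + 1) → K) :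
    householder (s • v) *ᵥ v = Pi.single 0 (algebraMap ℝ K (vecNorm v)) := by
  have h := householder_mulVec (s • v)
  rw [Matrix.mulVec_smul, vecNorm_smul, abs_of_pos hs, map_mul, ← Algebra.smul_def,
    Pi.single_smul] at h
  exact smul_right_injective _ hs.ne' h

/-- The reflection `Q` built from `‖c‖ r*` turns the rank one term `r* r` into `‖r‖² E₁₁`, which
passes through the algorithm by `tridiagonal_add_single`, and turns `Z* Z` into the Gram matrix of
`Z Q*`. -/
theorem tridiagonal_gram_consCol {m k : ℕ} {c : Fin (m + 1) → K} (hc : 0 < vecNorm c)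
    (r : Fin (k + 1) → K) (Z : Matrix (Fin m) (Fin (k + 1)) K) :
    tridiagonal (k + 1) ((consCol c ((householder c)ᴴ * consRow r Z))ᴴ *
        consCol c ((householder c)ᴴ * consRow r Z)) =
      wishartStep (vecNorm c, vecNorm r,
        tridiagonal k ((Z * (householder (vecNorm c • star r))ᴴ)ᴴ *
          (Z * (householder (vecNorm c • star r))ᴴ))) := by
  rw [gram_consCol_householder, tridiagonal_border, gram_mul_conjTranspose]
  have hQ := householder_smul_mulVec hc (star r)
  set Q := householder (vecNorm c • star r) with hQdef
  have hQ' : r ᵥ* Qᴴ = Pi.single 0 (algebraMap ℝ K (vecNorm (star r))) := by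
    have := congrArg star hQ
    rwa [Matrix.star_mulVec, star_star, ← Pi.single_star, star_algebraMap_real] at this
  have hsum : Q * (Matrix.vecMulVec (star r) r + Zᴴ * Z) * Qᴴ =
      Q * (Zᴴ * Z) * Qᴴ + Matrix.single 0 0 (algebraMap ℝ K (vecNorm r ^ 2)) := by
    rw [Matrix.mul_add, Matrix.add_mul, Matrix.mul_vecMulVec, Matrix.vecMulVec_mul, hQ,
      hQ', vecNorm_star]
    refine (add_comm _ _).trans (congrArg (Q * (Zᴴ * Z) * Qᴴ + ·) ?_)
    ext i j
    by_cases hi : i = 0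
    · subst hi
      by_cases hj : j = 0
      · subst hj; simp [Matrix.vecMulVec_apply, pow_two]
      · simp [Matrix.vecMulVec_apply, hj, Ne.symm hj]
    · simp [Matrix.vecMulVec_apply, hi, Ne.symm hi]
  rw [hsum, tridiagonal_add_single, vecNorm_smul, abs_of_pos hc, vecNorm_star]
  rfl

theorem measurable_gram {m n : ℕ} :
    Measurable fun Y : Matrix (Fin m) (Fin n) K => Yᴴ * Y :=
  (Measurable.matrix_conjTranspose measurable_star_scalar measurable_id).matrix_mul measurable_id

/-- Parametrizes a Gaussian matrix by its first column `c` and by the other columns seen in the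
frame where `c` is vertical. For fixed `c` this change of frame is unitary, so `c`, `r` and `Z` are
independent. -/
theorem measurePreserving_consCol_householder (m n : ℕ) :
    MeasurePreserving (fun p : (Fin (m + 1) → K) × (Fin n → K) × Matrix (Fin m) (Fin n) K =>
        consCol p.1 ((householder p.1)ᴴ * consRow p.2.1 p.2.2))
      ((gaussVector K (m + 1)).prod ((gaussVector K n).prod (gaussMatrix K m n)))
      (gaussMatrix K (m + 1) (n + 1)) := by
  have hskew := (MeasurePreserving.id (gaussVector K (m + 1))).skew_product
    (μc := (gaussVector K n).prod (gaussMatrix K m n)) (μd := gaussMatrix K (m + 1) n)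
    (g := fun c q => (householder c)ᴴ * consRow q.1 q.2)
    ((Measurable.matrix_conjTranspose measurable_star_scalar
      (measurable_householder.comp measurable_fst)).matrix_mul
      (measurable_consRow.comp measurable_snd))
    (ae_of_all _ fun c => ((measurePreserving_unitary_mul n
      (Unitary.star_mem (householder_mem_unitary c))).comp
        (measurePreserving_consRow m n)).map_eq)
  exact (measurePreserving_consCol (m + 1) n).comp hskew

theorem ae_vecNorm_pos (m : ℕ) : ∀ᵐ c ∂gaussVector K (m + 1), 0 < vecNorm c := by
  have h := measurePreserving_vecNorm (K := K) m.succ_pos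
  refine ae_of_ae_map (p := fun x : ℝ => 0 < x) h.measurable.aemeasurable ?_
  rw [h.map_eq, chi]
  exact (withDensity_absolutelyContinuous _ _).ae_le (ae_restrict_mem measurableSet_Ioi)

/-- Induction on the number of rows, with the number of columns left free since both decrease. For
fixed `c` and `r` the matrix `Z Q*` has the law of `Z`; two nested skew products turn this into the
independence of `‖c‖`, `‖r‖` and the smaller tridiagonal form. -/
theorem measurePreserving_tridiagonal_gram (m k : ℕ) :
    MeasurePreserving (fun Y => tridiagonal k (Yᴴ * Y)) (gaussMatrix K m (k + 1))
      (laguerreBetaEnsemble (dim K) m (k + 1)) := by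
  induction m generalizing k with
  | zero =>
    have : (fun Y : Matrix (Fin 0) (Fin (k + 1)) K => tridiagonal k (Yᴴ * Y)) = fun _ => 0 := by
      funext Y
      have : Yᴴ * Y = 0 := by ext i j; simp [Matrix.mul_apply]
      rw [this, tridiagonal_zero]
    rw [this, laguerreBetaEnsemble_zero]
    exact ⟨measurable_const, by rw [Measure.map_const, measure_univ, one_smul]⟩
  | succ m ih =>
    have hT (l : ℕ) : Measurable fun Y : Matrix (Fin (m + 1)) (Fin (l + 1)) K =>
        tridiagonal l (Yᴴ * Y) := (measurable_tridiagonal l).comp measurable_gram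
    refine ⟨hT k, ?_⟩
    cases k with
    | zero =>
      have hB := measurePreserving_consCol (K := K) (m + 1) 0
      have hfst : MeasurePreserving (fun p : (Fin (m + 1) → K) × Matrix (Fin (m + 1)) (Fin 0) K =>
          vecNorm p.1) ((gaussVector K (m + 1)).prod (gaussMatrix K (m + 1) 0))
          (chi (dim K * (m + 1 : ℕ))) :=
        (measurePreserving_vecNorm m.succ_pos).comp measurePreserving_fst
      have hm : Measurable fun t : ℝ => (Matrix.of fun _ _ => t ^ 2 : Matrix (Fin 1) (Fin 1) ℝ) :=
        measurable_matrix_of fun _ _ => measurable_id.pow_const 2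
      rw [laguerreBetaEnsemble_one dim_cast_pos, ← hB.map_eq, ← hfst.map_eq,
        Measure.map_map (hT 0) hB.measurable,
        Measure.map_map hm hfst.measurable]
      congr 1
      funext p
      ext i j
      have h := star_dotProduct_self p.1
      have h2 : ((consCol p.1 p.2)ᴴ * consCol p.1 p.2) 0 0 = star p.1 ⬝ᵥ p.1 := rfl
      simp [tridiagonal, h2, h, re_algebraMap, -map_pow]
    | succ k =>
      have hβ := dim_cast_pos (K := K)
      have i1 := isProbabilityMeasure_laguerreBetaEnsemble hβ m (k + 1)
      have hB := measurePreserving_consCol_householder (K := K) m (k + 1)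
      have hs : Measurable (star : K → K) := measurable_star_scalar
      have hs' : Measurable (star : (Fin (k + 1) → K) → (Fin (k + 1) → K)) :=
        measurable_pi_lambda _ fun i => hs.comp (measurable_pi_apply i)
      have hstep := (measurePreserving_vecNorm (K := K) m.succ_pos).skew_product
        (μc := (gaussVector K (k + 1)).prod (gaussMatrix K m (k + 1)))
        (μd := (chi (dim K * (k + 1 : ℕ))).prod (laguerreBetaEnsemble (dim K) m (k + 1)))
        (g := fun c q => (vecNorm q.1,
          tridiagonal k ((q.2 * (householder (vecNorm c • star q.1))ᴴ)ᴴ *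
            (q.2 * (householder (vecNorm c • star q.1))ᴴ))))
        (by
          refine (measurable_vecNorm.comp (measurable_fst.comp measurable_snd)).prodMk
            ((measurable_tridiagonal k).comp (measurable_gram.comp
              ((measurable_snd.comp measurable_snd).matrix_mul
                (Measurable.matrix_conjTranspose hs (measurable_householder.comp ?_)))))
          exact (measurable_vecNorm.comp measurable_fst).smul
            (hs'.comp (measurable_fst.comp measurable_snd)))
        (ae_of_all _ fun c => ((measurePreserving_vecNorm (K := K) k.succ_pos).skew_product
          (μc := gaussMatrix K m (k + 1)) (μd := laguerreBetaEnsemble (dim K) m (k + 1))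
          (g := fun r Z => tridiagonal k ((Z * (householder (vecNorm c • star r))ᴴ)ᴴ *
            (Z * (householder (vecNorm c • star r))ᴴ)))
          (by
            refine (measurable_tridiagonal k).comp (measurable_gram.comp
              (measurable_snd.matrix_mul
                (Measurable.matrix_conjTranspose hs (measurable_householder.comp ?_))))
            exact (hs'.comp measurable_fst).const_smul (vecNorm c))
          (ae_of_all _ fun r => ((ih k).comp (measurePreserving_mul_conjTranspose m
            (householder_mem_unitary _))).map_eq)).map_eq)
      rw [laguerreBetaEnsemble_succ_succ_succ hβ, ← hB.map_eq,
        Measure.map_map (hT (k + 1)) hB.measurable,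
        ← hstep.map_eq, Measure.map_map measurable_wishartStep hstep.measurable]
      -- The algebraic identity needs `‖c‖ > 0`, so the two maps are shown to agree only almost
      -- everywhere.
      refine Measure.map_congr ?_
      have hpos := (Measure.quasiMeasurePreserving_fst (μ := gaussVector K (m + 1))
        (ν := (gaussVector K (k + 1)).prod (gaussMatrix K m (k + 1)))).ae (ae_vecNorm_pos m)
      filter_upwards [hpos] with p hp
      exact tridiagonal_gram_consCol hp _ _

/-- The Wishart ensemble over `K`. -/
def gaussWishart (K : Type*) [NormedDivisionRing K] [NormedAlgebra ℝ K] [StarRing K]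
    [MeasurableSpace K] [GaussianScalars K] (m n : ℕ) : Measure (Matrix (Fin n) (Fin n) K) :=
  wishartEnsemble gauss m n

theorem measurePreserving_gram (m n : ℕ) :
    MeasurePreserving (fun Y => Yᴴ * Y) (gaussMatrix K m n) (gaussWishart K m n) :=
  ⟨measurable_gram, rfl⟩

theorem measurePreserving_tridiagonal_gaussWishart (m k : ℕ) :
    MeasurePreserving (tridiagonal k) (gaussWishart K m (k + 1))
      (laguerreBetaEnsemble (dim K) m (k + 1)) := by
  refine ⟨measurable_tridiagonal k, ?_⟩
  rw [← (measurePreserving_gram m (k + 1)).map_eq, Measure.map_map (measurable_tridiagonal k)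
    measurable_gram]
  exact (measurePreserving_tridiagonal_gram m k).map_eq

theorem measurePreserving_conj_gaussWishart (m : ℕ) {n : ℕ} {U : Matrix (Fin n) (Fin n) K}
    (hU : U ∈ unitary (Matrix (Fin n) (Fin n) K)) :
    MeasurePreserving (fun H => U * H * Uᴴ) (gaussWishart K m n) (gaussWishart K m n) := by
  have hm : Measurable fun H : Matrix (Fin n) (Fin n) K => U * H * Uᴴ :=
    measurable_conj measurable_const measurable_id
  refine ⟨hm, ?_⟩
  have h1 := (measurePreserving_gram (K := K) m n).comp (measurePreserving_mul_conjTranspose m hU)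
  conv_lhs => rw [← (measurePreserving_gram m n).map_eq]
  rw [Measure.map_map hm measurable_gram, ← h1.map_eq]
  congr 1
  funext Y
  exact (gram_mul_conjTranspose U Y).symm

theorem measurableSet_isHermitian (n : ℕ) :
    MeasurableSet {H : Matrix (Fin n) (Fin n) K | H.IsHermitian} := by
  have hs : Measurable (star : K → K) := measurable_star_scalar
  have : {H : Matrix (Fin n) (Fin n) K | H.IsHermitian} =
      ⋂ i, ⋂ j, {H | star (H j i) = H i j} := by
    ext H
    simp [Matrix.IsHermitian.ext_iff]
  rw [this]
  exact MeasurableSet.iInter fun i => MeasurableSet.iInter fun j =>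
    measurableSet_eq_fun (hs.comp (measurable_id.matrix_apply j i)) (measurable_id.matrix_apply i j)

theorem ae_isHermitian_gaussHermitian (n : ℕ) : ∀ᵐ H ∂gaussHermitian K n, H.IsHermitian := by
  rw [← (measurePreserving_hermitianPart n).map_eq,
    ae_map_iff measurable_hermitianPart.aemeasurable (measurableSet_isHermitian n)]
  exact ae_of_all _ isHermitian_hermitianPart

theorem ae_isHermitian_gaussWishart (m n : ℕ) : ∀ᵐ H ∂gaussWishart K m n, H.IsHermitian := by
  rw [← (measurePreserving_gram m n).map_eq,
    ae_map_iff measurable_gram.aemeasurable (measurableSet_isHermitian n)]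
  exact ae_of_all _ fun Y => by simp [Matrix.IsHermitian, Matrix.conjTranspose_mul]

/-! ### The matrix model -/

theorem tridiagonalizer_conj_single {k : ℕ} (H : Matrix (Fin (k + 1)) (Fin (k + 1)) K) (x : K) :
    tridiagonalizer k H * Matrix.single 0 0 x * (tridiagonalizer k H)ᴴ = Matrix.single 0 0 x := by
  have h : Matrix.single 0 0 x =
      Matrix.vecMulVec (Pi.single (0 : Fin (k + 1)) x) (Pi.single (0 : Fin (k + 1)) 1) := by
    ext i j
    by_cases hi : i = 0
    · subst hi
      by_cases hj : j = 0
      · subst hj; simp [Matrix.vecMulVec_apply]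
      · simp [Matrix.vecMulVec_apply, hj, Ne.symm hj]
    · simp [Matrix.vecMulVec_apply, hi, Ne.symm hi]
  rw [h, Matrix.mul_vecMulVec, Matrix.vecMulVec_mul, tridiagonalizer_mulVec_single,
    single_vecMul_conjTranspose_tridiagonalizer]

theorem measurable_hsNorm {n : ℕ} : Measurable (hsNorm : Matrix (Fin n) (Fin n) K → ℝ) := by
  unfold hsNorm
  refine Measurable.sqrt (Finset.measurable_fun_sum _ fun i _ =>
    Finset.measurable_fun_sum _ fun j _ => ?_)
  exact ((measurable_id.matrix_apply i j).norm).pow_const 2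

/-- Since `ρ` is a star homomorphism and the complex scalar `i` is central in the algebra `A`,
conjugation acts on both terms separately inside `K`. -/
theorem conj_effective {A : Type*} [Ring A] [StarRing A] [Algebra ℂ A] {ρ : K →+* A}
    (hstar : ∀ x, ρ (star x) = star (ρ x)) {n : ℕ} (V H G : Matrix (Fin n) (Fin n) K) :
    V.map ρ * effective ρ H G * (V.map ρ)ᴴ = effective ρ (V * H * Vᴴ) (V * G * Vᴴ) := by
  have hV : (V.map ρ)ᴴ = Vᴴ.map ρ := by
    ext i j
    simp [hstar]
  simp only [effective, hV, Matrix.map_mul, Matrix.mul_add, Matrix.add_mul, Matrix.mul_smul,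
    Matrix.smul_mul]

theorem effective_eq_perturbedModel {A : Type*} [Ring A] [Algebra ℂ A] {ρ : K →+* A}
    (hreal : ∀ r : ℝ, ρ (algebraMap ℝ K r) = algebraMap ℂ A r) {k : ℕ}
    (J : Matrix (Fin (k + 1)) (Fin (k + 1)) ℝ) (l : ℝ) :
    effective ρ (J.map (algebraMap ℝ K)) (Matrix.single 0 0 (algebraMap ℝ K l)) =
      perturbedModel A J l := by
  rw [effective, perturbedModel]
  congr 1
  · ext i j
    simp [hreal]
  · ext i j
    rw [mul_smul]
    simp only [Matrix.smul_apply, Matrix.map_apply, topLeft, Matrix.of_apply, Matrix.single_apply]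
    congr 1
    by_cases h : i = 0 ∧ j = 0
    · have h1 : (i : ℕ) = 0 ∧ (j : ℕ) = 0 := by simp [h.1, h.2]
      have h2 : 0 = i ∧ 0 = j := ⟨h.1.symm, h.2.symm⟩
      rw [if_pos h1, if_pos h2, hreal, Algebra.smul_def, mul_one]
    · have h1 : ¬ ((i : ℕ) = 0 ∧ (j : ℕ) = 0) := fun h' => h ⟨Fin.ext h'.1, Fin.ext h'.2⟩
      have h2 : ¬ (0 = i ∧ 0 = j) := fun h' => h ⟨h'.1.symm, h'.2.symm⟩
      rw [if_neg h1, if_neg h2, map_zero, smul_zero]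

/-- The matrix model for a random Hermitian matrix with unitarily invariant law. -/
theorem hasTridiagonalModel_of_invariant {A : Type*} [Ring A] [StarRing A] [Algebra ℂ A]
    {ρ : K →+* A} (hstar : ∀ x, ρ (star x) = star (ρ x))
    (hreal : ∀ r : ℝ, ρ (algebraMap ℝ K r) = algebraMap ℂ A r)
    {Ω : Type*} [MeasurableSpace Ω] {μ : Measure Ω} [IsProbabilityMeasure μ] {k : ℕ}
    {H G : Ω → Matrix (Fin (k + 1)) (Fin (k + 1)) K}
    {ν : Measure (Matrix (Fin (k + 1)) (Fin (k + 1)) K)}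
    {ν' : Measure (Matrix (Fin (k + 1)) (Fin (k + 1)) ℝ)}
    (hG : IsRankOnePerturbation μ H G) (hH : HasLaw H ν μ)
    (hinv : ∀ U ∈ unitary (Matrix (Fin (k + 1)) (Fin (k + 1)) K),
      MeasurePreserving (fun X => U * X * Uᴴ) ν ν)
    (hherm : ∀ᵐ X ∂ν, X.IsHermitian) (htri : MeasurePreserving (tridiagonal k) ν ν') :
    HasTridiagonalModel ρ μ H G ν' := by
  obtain ⟨U, hUm, hU, hUG⟩ := exists_measurable_unitary_diagonalizing (K := K) k
  have hν : IsProbabilityMeasure ν := by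
    rw [← hH.map_eq]; exact Measure.isProbabilityMeasure_map hH.aemeasurable
  -- `V` has to be measurable and unitary at every point, while `G` and `H` are only almost
  -- everywhere measurable; hence the measurable modifications.
  set G' := hG.aemeasurable.mk G with hG'
  have hG'm : Measurable G' := hG.aemeasurable.measurable_mk
  have hGG' : G =ᵐ[μ] G' := hG.aemeasurable.ae_eq_mk
  set H' := hH.aemeasurable.mk H with hH'
  have hH'm : Measurable H' := hH.aemeasurable.measurable_mk
  have hHH' : H =ᵐ[μ] H' := hH.aemeasurable.ae_eq_mk
  have hH'law : μ.map H' = ν := by rw [← hH.map_eq]; exact (Measure.map_congr hHH').symm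
  have hindep : IndepFun G' H' μ := (hG.indep.congr hHH' hGG').symm
  have hjoint : MeasurePreserving (fun ω => (G' ω, H' ω)) μ ((μ.map G').prod ν) :=
    ⟨hG'm.prodMk hH'm, by
      rw [(indepFun_iff_map_prod_eq_prod_map_map hG'm.aemeasurable hH'm.aemeasurable).1 hindep,
        hH'law]⟩
  have : IsProbabilityMeasure (μ.map G') := Measure.isProbabilityMeasure_map hG'm.aemeasurable
  set X : Ω → Matrix (Fin (k + 1)) (Fin (k + 1)) K :=
    fun ω => U (G' ω) * H' ω * (U (G' ω))ᴴ with hX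
  -- For every fixed value of `G'` conjugation by `U G'` preserves `ν`, so the pair `(G', X)` has
  -- the same product law as `(G', H')`.
  have hGX : MeasurePreserving (fun ω => (G' ω, X ω)) μ ((μ.map G').prod ν) :=
    ((MeasurePreserving.id (μ.map G')).skew_product (μc := ν) (μd := ν)
      (g := fun G H => U G * H * (U G)ᴴ)
      (measurable_conj (hUm.comp measurable_fst) measurable_snd)
      (ae_of_all _ fun G => (hinv _ (hU G)).map_eq)).comp hjoint
  have hXlaw : MeasurePreserving X μ ν := measurePreserving_snd.comp hGX
  have hXindep : IndepFun G' X μ := by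
    rw [indepFun_iff_map_prod_eq_prod_map_map hG'm.aemeasurable hXlaw.measurable.aemeasurable,
      hXlaw.map_eq, hGX.map_eq]
  refine ⟨fun ω => tridiagonalizer k (X ω) * U (G' ω), fun ω => tridiagonal k (X ω),
    ((measurable_tridiagonalizer k).comp hXlaw.measurable).matrix_mul (hUm.comp hG'm),
    fun ω => mul_mem (tridiagonalizer_mem_unitary k _) (hU _),
    ⟨(htri.comp hXlaw).measurable.aemeasurable, (htri.comp hXlaw).map_eq⟩, ?_, ?_⟩
  · refine (hXindep.symm.comp (measurable_tridiagonal k) measurable_hsNorm).congr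
      (Filter.EventuallyEq.refl _ _) ?_
    filter_upwards [hGG'] with ω hω
    simp [hω]
  · have hherm' : ∀ᵐ ω ∂μ, (H' ω).IsHermitian :=
      ae_of_ae_map hH'm.aemeasurable (by rw [hH'law]; exact hherm)
    filter_upwards [hGG', hHH', hherm', hG.positive, hG.rank_eq_one] with ω h1 h2 h3 h4 h5
    -- Both sides become the effective matrix of two conjugates: the tridiagonalizer maps `X` to the
    -- tridiagonal form and fixes `l E₁₁`, which is itself the conjugate of `G` by `U`.
    rw [conj_effective hstar, ← effective_eq_perturbedModel hreal,
      ← tridiagonalizer_conj k (isHermitian_conj h3 (U (G' ω)) : (X ω).IsHermitian),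
      ← tridiagonalizer_conj_single (X ω), ← hUG (G ω) h4 h5, h1, h2]
    simp only [hX, Matrix.conjTranspose_mul, Matrix.mul_assoc]

theorem hasTridiagonalModel_gaussHermitian {A : Type*} [Ring A] [StarRing A] [Algebra ℂ A]
    {ρ : K →+* A} (hstar : ∀ x, ρ (star x) = star (ρ x))
    (hreal : ∀ r : ℝ, ρ (algebraMap ℝ K r) = algebraMap ℂ A r)
    {Ω : Type*} [MeasurableSpace Ω] {μ : Measure Ω} [IsProbabilityMeasure μ] {n : ℕ}
    {H G : Ω → Matrix (Fin n) (Fin n) K} (hG : IsRankOnePerturbation μ H G)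
    (hH : HasLaw H (gaussHermitian K n) μ) :
    HasTridiagonalModel ρ μ H G (gaussianBetaEnsemble (dim K) n) := by
  cases n with
  | zero =>
    -- No matrix of size zero has rank one. Under a probability measure an almost sure property
    -- holds at some point, which gives the contradiction.
    obtain ⟨ω, hω⟩ := hG.rank_eq_one.exists
    exact (ne_zero_of_rightRank_eq_one hω).elim fun j _ => j.elim0
  | succ k =>
    exact hasTridiagonalModel_of_invariant hstar hreal hG hH
      (fun U hU => measurePreserving_conj_gaussHermitian hU) (ae_isHermitian_gaussHermitian _)
      (measurePreserving_tridiagonal_gaussHermitian k)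

theorem hasTridiagonalModel_gaussWishart {A : Type*} [Ring A] [StarRing A] [Algebra ℂ A]
    {ρ : K →+* A} (hstar : ∀ x, ρ (star x) = star (ρ x))
    (hreal : ∀ r : ℝ, ρ (algebraMap ℝ K r) = algebraMap ℂ A r)
    {Ω : Type*} [MeasurableSpace Ω] {μ : Measure Ω} [IsProbabilityMeasure μ] {m n : ℕ}
    {H G : Ω → Matrix (Fin n) (Fin n) K} (hG : IsRankOnePerturbation μ H G)
    (hH : HasLaw H (gaussWishart K m n) μ) :
    HasTridiagonalModel ρ μ H G (laguerreBetaEnsemble (dim K) m n) := by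
  cases n with
  | zero =>
    obtain ⟨ω, hω⟩ := hG.rank_eq_one.exists
    exact (ne_zero_of_rightRank_eq_one hω).elim fun j _ => j.elim0
  | succ k =>
    exact hasTridiagonalModel_of_invariant hstar hreal hG hH
      (fun U hU => measurePreserving_conj_gaussWishart m hU) (ae_isHermitian_gaussWishart _ _)
      (measurePreserving_tridiagonal_gaussWishart m k)

end Laws

/-! ### The real, complex and quaternionic scalars -/

instance borelSpace_quaternion : BorelSpace ℍ[ℝ] := ⟨rfl⟩

instance starModule_quaternion : StarModule ℝ ℍ[ℝ] :=
  ⟨fun r x => by rw [Quaternion.star_smul, star_trivial r]⟩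

instance gaussianScalarsReal : GaussianScalars ℝ where
  re := LinearMap.id
  dim := 1
  gauss := gaussianReal 0 1
  dim_pos := one_pos
  measurable_re := measurable_id
  re_star _ := rfl
  re_algebraMap _ := rfl
  star_mul_self_eq x := by simp [pow_two]
  eq_algebraMap_re _ _ := rfl
  isStdGaussian_gauss :=
    ⟨LinearEquiv.funUnique (Fin 1) ℝ ℝ, measurable_pi_apply _, fun x => by simp,
      (measurePreserving_eval (fun _ : Fin 1 => gaussianReal 0 1) default).map_eq.symm⟩
  map_re_gauss := Measure.map_id

/-- The linear coordinates of a complex number. -/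
def complexCoordinates : (Fin 2 → ℝ) ≃ₗ[ℝ] ℂ where
  toFun x := ⟨x 0, x 1⟩
  invFun z := ![z.re, z.im]
  map_add' _ _ := rfl
  map_smul' c x := by apply Complex.ext <;> simp
  left_inv x := by ext i; fin_cases i <;> rfl
  right_inv _ := rfl

theorem measurable_complexCoordinates : Measurable complexCoordinates :=
  complexCoordinates.toLinearMap.continuous_of_finiteDimensional.measurable

theorem gaussianComplex_eq :
    gaussianComplex = (Measure.pi fun _ : Fin 2 => gaussianReal 0 1).map complexCoordinates := by
  have h := measurePreserving_finTwoArrow (gaussianReal 0 1)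
  have hm : Measurable fun p : ℝ × ℝ => (⟨p.1, p.2⟩ : ℂ) :=
    Complex.measurableEquivRealProd.symm.measurable
  rw [gaussianComplex, ← h.map_eq, Measure.map_map hm h.measurable]
  rfl

instance gaussianScalarsComplex : GaussianScalars ℂ where
  re := Complex.reLm
  dim := 2
  gauss := gaussianComplex
  dim_pos := two_pos
  measurable_re := Complex.measurable_re
  re_star _ := rfl
  re_algebraMap _ := rfl
  star_mul_self_eq x := by
    simpa [mul_comm] using Complex.mul_conj' x
  eq_algebraMap_re x hx := (Complex.conj_eq_iff_re.1 hx).symm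
  isStdGaussian_gauss :=
    ⟨complexCoordinates, measurable_complexCoordinates, fun x => by
      beta_reduce
      rw [Complex.sq_norm, Complex.normSq_apply, Fin.sum_univ_two, pow_two, pow_two]
      rfl, gaussianComplex_eq⟩
  map_re_gauss := by
    have hm : Measurable Complex.reLm := Complex.measurable_re
    rw [gaussianComplex_eq, Measure.map_map hm measurable_complexCoordinates]
    exact (measurePreserving_eval (fun _ : Fin 2 => gaussianReal 0 1) 0).map_eq

/-- The linear coordinates of a quaternion. -/
def quaternionCoordinates : (Fin 4 → ℝ) ≃ₗ[ℝ] ℍ[ℝ] where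
  toEquiv := (Quaternion.equivTuple ℝ).symm
  map_add' _ _ := rfl
  map_smul' _ _ := rfl

theorem measurable_quaternionCoordinates : Measurable quaternionCoordinates :=
  quaternionCoordinates.toLinearMap.continuous_of_finiteDimensional.measurable

/-- The real part of a quaternion as a linear map. -/
def quaternionRe : ℍ[ℝ] →ₗ[ℝ] ℝ where
  toFun q := q.re
  map_add' _ _ := rfl
  map_smul' _ _ := rfl

theorem measurable_quaternionRe : Measurable quaternionRe :=
  quaternionRe.continuous_of_finiteDimensional.measurable

instance gaussianScalarsQuaternion : GaussianScalars ℍ[ℝ] where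
  re := quaternionRe
  dim := 4
  gauss := gaussianQuaternion
  dim_pos := four_pos
  measurable_re := measurable_quaternionRe
  re_star x := Quaternion.re_star x
  re_algebraMap _ := rfl
  star_mul_self_eq x := by
    rw [Quaternion.star_mul_self, Quaternion.normSq_eq_norm_mul_self, pow_two]
    rfl
  eq_algebraMap_re x hx := Quaternion.star_eq_self.1 hx
  isStdGaussian_gauss :=
    ⟨quaternionCoordinates, measurable_quaternionCoordinates, fun x => by
      beta_reduce
      rw [pow_two, ← Quaternion.normSq_eq_norm_mul_self, Quaternion.normSq_def',
        Fin.sum_univ_four]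
      rfl, rfl⟩
  map_re_gauss := by
    have h : gaussianQuaternion =
      (Measure.pi fun _ : Fin 4 => gaussianReal 0 1).map quaternionCoordinates := rfl
    rw [h, Measure.map_map measurable_quaternionRe measurable_quaternionCoordinates]
    exact (measurePreserving_eval (fun _ : Fin 4 => gaussianReal 0 1) 0).map_eq

/-- The representation of quaternions by complex matrices as a ring homomorphism. -/
def quaternionToMatrixHom : ℍ[ℝ] →+* Matrix (Fin 2) (Fin 2) ℂ where
  toFun := quaternionToMatrix
  map_one' := by
    ext i j
    fin_cases i <;> fin_cases j <;> apply Complex.ext <;> simp [quaternionToMatrix]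
  map_zero' := by
    ext i j
    fin_cases i <;> fin_cases j <;> apply Complex.ext <;> simp [quaternionToMatrix]
  map_add' x y := by
    ext i j
    fin_cases i <;> fin_cases j <;> apply Complex.ext <;> simp [quaternionToMatrix] <;> ring
  map_mul' x y := by
    ext i j
    fin_cases i <;> fin_cases j <;> apply Complex.ext <;>
      simp [quaternionToMatrix, Matrix.mul_apply] <;> ring

theorem quaternionToMatrix_star (x : ℍ[ℝ]) :
    quaternionToMatrix (star x) = star (quaternionToMatrix x) := by
  ext i j
  fin_cases i <;> fin_cases j <;> apply Complex.ext <;>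
    simp [quaternionToMatrix, Matrix.star_apply]

theorem quaternionToMatrix_algebraMap (r : ℝ) :
    quaternionToMatrix (algebraMap ℝ ℍ[ℝ] r) = algebraMap ℂ (Matrix (Fin 2) (Fin 2) ℂ) r := by
  ext i j
  fin_cases i <;> fin_cases j <;> apply Complex.ext <;>
    simp [quaternionToMatrix, Matrix.algebraMap_matrix_apply]

end RankOnePerturbation

end

/-! ### The theorem for the six ensembles -/

theorem theorem3p1 {Ω : Type*} [MeasurableSpace Ω] (μ : Measure Ω) [IsProbabilityMeasure μ]
    (m n : ℕ) :
    (∀ H G : Ω → Matrix (Fin n) (Fin n) ℝ, RankOnePerturbation.IsRankOnePerturbation μ H G →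
      (HasLaw H (RankOnePerturbation.GOE n) μ →
        RankOnePerturbation.HasTridiagonalModel (fun t : ℝ => (t : ℂ)) μ H G
          (RankOnePerturbation.gaussianBetaEnsemble 1 n)) ∧
      (HasLaw H (RankOnePerturbation.LOE m n) μ →
        RankOnePerturbation.HasTridiagonalModel (fun t : ℝ => (t : ℂ)) μ H G
          (RankOnePerturbation.laguerreBetaEnsemble 1 m n))) ∧
    (∀ H G : Ω → Matrix (Fin n) (Fin n) ℂ, RankOnePerturbation.IsRankOnePerturbation μ H G →
      (HasLaw H (RankOnePerturbation.GUE n) μ →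
        RankOnePerturbation.HasTridiagonalModel (fun z : ℂ => z) μ H G
          (RankOnePerturbation.gaussianBetaEnsemble 2 n)) ∧
      (HasLaw H (RankOnePerturbation.LUE m n) μ →
        RankOnePerturbation.HasTridiagonalModel (fun z : ℂ => z) μ H G
          (RankOnePerturbation.laguerreBetaEnsemble 2 m n))) ∧
    (∀ H G : Ω → Matrix (Fin n) (Fin n) ℍ[ℝ], RankOnePerturbation.IsRankOnePerturbation μ H G →
      (HasLaw H (RankOnePerturbation.GSE n) μ →
        RankOnePerturbation.HasTridiagonalModel RankOnePerturbation.quaternionToMatrix μ H G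
          (RankOnePerturbation.gaussianBetaEnsemble 4 n)) ∧
      (HasLaw H (RankOnePerturbation.LSE m n) μ →
        RankOnePerturbation.HasTridiagonalModel RankOnePerturbation.quaternionToMatrix μ H G
          (RankOnePerturbation.laguerreBetaEnsemble 4 m n))) := by
  -- The parameter `β` is the real dimension of the scalars, so the general results only need the
  -- cast of `dim` to be evaluated.
  have h1 : ((RankOnePerturbation.GaussianScalars.dim ℝ : ℕ) : ℝ) = 1 := Nat.cast_one
  have h2 : ((RankOnePerturbation.GaussianScalars.dim ℂ : ℕ) : ℝ) = 2 := Nat.cast_ofNat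
  have h4 : ((RankOnePerturbation.GaussianScalars.dim ℍ[ℝ] : ℕ) : ℝ) = 4 :=
    (Nat.cast_ofNat : ((OfNat.ofNat 4 : ℕ) : ℝ) = OfNat.ofNat 4)
  refine ⟨fun H G hG => ⟨fun hH => ?_, fun hH => ?_⟩, fun H G hG => ⟨fun hH => ?_, fun hH => ?_⟩,
    fun H G hG => ⟨fun hH => ?_, fun hH => ?_⟩⟩
  · rw [← h1]
    exact RankOnePerturbation.hasTridiagonalModel_gaussHermitian (ρ := Complex.ofRealHom)
      (fun x => (Complex.conj_ofReal x).symm) (fun _ => rfl) hG hH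
  · rw [← h1]
    exact RankOnePerturbation.hasTridiagonalModel_gaussWishart (ρ := Complex.ofRealHom)
      (fun x => (Complex.conj_ofReal x).symm) (fun _ => rfl) hG hH
  · rw [← h2]
    exact RankOnePerturbation.hasTridiagonalModel_gaussHermitian (ρ := RingHom.id ℂ)
      (fun _ => rfl) (fun _ => rfl) hG hH
  · rw [← h2]
    exact RankOnePerturbation.hasTridiagonalModel_gaussWishart (ρ := RingHom.id ℂ)
      (fun _ => rfl) (fun _ => rfl) hG hH
  · rw [← h4]
    exact RankOnePerturbation.hasTridiagonalModel_gaussHermitian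
      (ρ := RankOnePerturbation.quaternionToMatrixHom)
      RankOnePerturbation.quaternionToMatrix_star
      RankOnePerturbation.quaternionToMatrix_algebraMap hG hH
  · rw [← h4]
    exact RankOnePerturbation.hasTridiagonalModel_gaussWishart
      (ρ := RankOnePerturbation.quaternionToMatrixHom)
      RankOnePerturbation.quaternionToMatrix_star
      RankOnePerturbation.quaternionToMatrix_algebraMap hG hH
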